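/- **Notation.** For $m\ge 2$ let $T_m$ be the rooted tree whose vertices are the finite words in an ordered alphabet of $m$ letters (the root is the empty word, the children of $v$ are the words $vx$, the $n$th level consists of the words of length $n$), and let $\mathrm{Aut}\,T_m$ be its automorphism group with the congruence topology, in which the level stabilizers $\mathrm{St}(n)$ form a neighbourhood basis of $1$. The label of $g$ at a vertex $v$ is the permutation $\tau$ of the letters with $g(vx)=g(v)\tau(x)$. Put $\sigma=(1\,2\cdots m)$ and let $\Gamma_m\le \mathrm{Aut}\,T_m$ be the group of automorphisms all of whose labels lie in $\langle\sigma\rangle$. For $G\le\mathrm{Aut}\,T_m$ let $\mathrm{rist}_G(v)$ be the group of elements of $G$ that fix every vertex outside the subtree hanging from $v$, and let $\mathrm{Rist}_G(n)$ be the product of the groups $\mathrm{rist}_G(v)$ over the vertices $v$ of level $n$. The group $G$ is *branch* if it is transitive on every level of $T_m$ and every $\mathrm{Rist}_G(n)$ is non-trivial and of finite index in $G$. A discrete group is *just infinite* if it is infinite and all its non-trivial normal subgroups have finite index; a profinite group is *just infinite* if it is infinite and all its non-trivial closed normal subgroups are open. A closed subgroup $H\le\Gamma_m$ is said to have *zero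 Hausdorff dimension in $\Gamma_m$* if $$\liminf_{n\to\infty}\frac{\log|H:\mathrm{St}_H(n)|}{\log|\Gamma_m:\mathrm{St}_{\Gamma_m}(n)|}=0$$ and $H$ has Hausdorff dimension $0$ as a subset of $\Gamma_m$ for the metric $d(g,h)=\inf\{|\Gamma_m:\mathrm{St}_{\Gamma_m}(n)|^{-1} : g,h \text{ agree on level } n\}$. **Staircase groups.** Let $q\ge 5$, let $a\in\Gamma_q$ be the rooted automorphism given by $\sigma$ (label $\sigma$ at the root, trivial labels elsewhere), and for $i\ge 0$ let $d_i(a)$ be the automorphism with label $\sigma$ at every vertex of level $i$ and trivial labels elsewhere. Put $l_1=2$ and $l_{n+1}=q^{l_n-1}$. For $n\ge1$ the automorphism $b_n$ fixes level $l_n$ and acts on the subtrees hanging from the vertices of level $l_n$, taken in lexicographical order, as $$\big(d_0(a),d_1(a),\dots,d_{q^{l_n-1}-1}(a),1,\dots,1,b_{n+1}\big).$$ Put $A_n=\langle d_i(a) : 0\le i\le l_n-1\rangle$ and $G_n=\langle A_n,b_n\rangle\le\Gamma_q$. **Theorem.** Let $p$ be a prime. 1. There is a closed subgroup $H\le\Gamma_p$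 that is a just infinite (profinite) branch pro-$p$ group with zero Hausdorff dimension in $\Gamma_p$. Moreover, $H$ can be taken to be the closure of a finitely generated subgroup of $\Gamma_p$ that is branch and just infinite as a discrete group. 2. For every power $q\ge 5$ of $p$ and every $n\ge 1$, the group $G_n\le\Gamma_q$ is finitely generated, level-transitive, branch and just infinite. Its closure is a just infinite (profinite) branch pro-$p$ group contained in $\Gamma_q$, with zero Hausdorff dimension in $\Gamma_q$. -/

import Mathlib

open Filter Topology
open scoped ENNReal NNReal

/-! ### The rooted tree and its automorphisms

Vertices of the `m`-adic tree are the finite words over `Fin m`; the root is the empty word, the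
children of `v` are the words `v ++ [x]`, and the level of a vertex is its length. -/

/-- The automorphism group of the `m`-adic rooted tree: permutations of the set of words that
preserve the length and the relation of being a prefix. -/
def treeAut (m : ℕ) : Subgroup (Equiv.Perm (List (Fin m))) where
  carrier := {g | (∀ v, (g v).length = v.length) ∧ ∀ u v, u <+: v ↔ g u <+: g v}
  mul_mem' := by
    intro a b ha hb
    refine ⟨fun v => ?_, fun u v => ?_⟩
    · rw [Equiv.Perm.mul_apply, ha.1, hb.1]
    · rw [Equiv.Perm.mul_apply, Equiv.Perm.mul_apply, ← ha.2, ← hb.2]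
  one_mem' := ⟨fun _ => rfl, fun _ _ => Iff.rfl⟩
  inv_mem' := by
    intro a ha
    refine ⟨fun v => ?_, fun u v => ?_⟩
    · have h := ha.1 (a⁻¹ v)
      rw [show a (a⁻¹ v) = v from a.apply_symm_apply v] at h
      exact h.symm
    · rw [ha.2 (a⁻¹ u) (a⁻¹ v), show a (a⁻¹ u) = u from a.apply_symm_apply u,
        show a (a⁻¹ v) = v from a.apply_symm_apply v]

/-- The group of automorphisms of the `m`-adic tree. -/
abbrev TreeAut (m : ℕ) : Type := ↥(treeAut m)

namespace TreeAut

variable {m : ℕ}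

/-- The image `g v` of the vertex `v` under `g`. -/
def app (g : TreeAut m) (v : List (Fin m)) : List (Fin m) := g.1 v

theorem app_one (v : List (Fin m)) : app (1 : TreeAut m) v = v := rfl

theorem app_mul (g h : TreeAut m) (v : List (Fin m)) : app (g * h) v = app g (app h v) := rfl

theorem length_app (g : TreeAut m) (v : List (Fin m)) : (app g v).length = v.length := g.2.1 v

theorem app_inv_app (g : TreeAut m) (v : List (Fin m)) : app g⁻¹ (app g v) = v :=
  g.1.symm_apply_apply v

theorem app_app_inv (g : TreeAut m) (v : List (Fin m)) : app g (app g⁻¹ v) = v :=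
  g.1.apply_symm_apply v

theorem ext_app {g h : TreeAut m} (H : ∀ v, app g v = app h v) : g = h :=
  Subtype.ext (Equiv.ext H)

/-- `HasLabel g v τ`: the label of `g` at the vertex `v` is the permutation `τ`, that is,
`g (v x) = g (v) τ(x)` for every letter `x`. -/
def HasLabel (g : TreeAut m) (v : List (Fin m)) (τ : Equiv.Perm (Fin m)) : Prop :=
  ∀ x, app g (v ++ [x]) = app g v ++ [τ x]

/-- The `n`-th level stabilizer `St(n)` of the whole automorphism group. -/
def levelStab (m n : ℕ) : Subgroup (TreeAut m) where
  carrier := {g | ∀ v, v.length = n → app g v = v}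
  mul_mem' := by
    intro a b ha hb v hv
    rw [app_mul, hb v hv, ha v hv]
  one_mem' := fun _ _ => rfl
  inv_mem' := by
    intro a ha v hv
    conv_lhs => rw [← ha v hv]
    exact app_inv_app a v

theorem levelStab_anti {i j : ℕ} (hij : i ≤ j) (hm : 0 < m) : levelStab m j ≤ levelStab m i := by
  intro g hg v hv
  have h1 := hg (v ++ List.replicate (j - i) ⟨0, hm⟩) (by simp [hv, hij])
  have h2 := (g.2.2 v (v ++ List.replicate (j - i) ⟨0, hm⟩)).1 (List.prefix_append _ _)
  change app g v <+: app g _ at h2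
  rw [h1] at h2
  have h3 := List.prefix_of_prefix_length_le h2 (List.prefix_append _ _)
    (le_of_eq (length_app g v))
  exact h3.eq_of_length (length_app g v)

/-- The congruence topology: the subspace topology of the product of discrete spaces
`List (Fin m) → List (Fin m)`. As every level is finite, the subgroups `St(n)` form a
neighbourhood basis of the identity. -/
instance : TopologicalSpace (TreeAut m) :=
  TopologicalSpace.induced app (@Pi.topologicalSpace (List (Fin m)) (fun _ => List (Fin m))
    (fun _ => ⊥))

theorem isOpen_setOf_app_eq (v w : List (Fin m)) : IsOpen {g : TreeAut m | app g v = w} := by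
  let _ : TopologicalSpace (List (Fin m)) := ⊥
  have _ : DiscreteTopology (List (Fin m)) := ⟨rfl⟩
  have h : Continuous (fun g : TreeAut m => app g v) :=
    (continuous_apply v).comp continuous_induced_dom
  exact (isOpen_discrete {w}).preimage h

theorem continuous_of_app {X : Type*} [TopologicalSpace X] (f : X → TreeAut m)
    (hf : ∀ v w, IsOpen {x | app (f x) v = w}) : Continuous f := by
  let _ : TopologicalSpace (List (Fin m)) := ⊥
  have _ : DiscreteTopology (List (Fin m)) := ⟨rfl⟩
  refine continuous_induced_rng.2 (continuous_pi fun v => ?_)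
  rw [continuous_discrete_rng]
  exact fun w => hf v w

instance : IsTopologicalGroup (TreeAut m) where
  continuous_mul := by
    refine continuous_of_app _ fun v w => ?_
    have : {x : TreeAut m × TreeAut m | app (x.1 * x.2) v = w} =
        ⋃ u, {g | app g u = w} ×ˢ {h | app h v = u} := by
      ext x
      simp [app_mul]
    rw [this]
    exact isOpen_iUnion fun u => (isOpen_setOf_app_eq u w).prod (isOpen_setOf_app_eq v u)
  continuous_inv := by
    refine continuous_of_app _ fun v w => ?_
    have : {g : TreeAut m | app g⁻¹ v = w} = {g | app g w = v} := by
      ext g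
      constructor
      · rintro rfl
        exact app_app_inv g v
      · rintro rfl
        exact app_inv_app g w
    rw [this]
    exact isOpen_setOf_app_eq w v

/-- The congruence topology is the one given by the level stabilizers: a set is open if and only
if with each `g` it contains the coset `g St(n)` for some `n`. -/
theorem isOpen_iff_levelStab (U : Set (TreeAut m)) :
    IsOpen U ↔ ∀ g ∈ U, ∃ n, ∀ h ∈ levelStab m n, g * h ∈ U := by
  constructor
  · intro hU g hg
    let _ : TopologicalSpace (List (Fin m)) := ⊥
    have _ : DiscreteTopology (List (Fin m)) := ⟨rfl⟩
    obtain ⟨V, hV, rfl⟩ := isOpen_induced_iff.1 hU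
    obtain ⟨I, u, hI, hIu⟩ := isOpen_pi_iff.1 hV _ hg
    refine ⟨I.sup List.length, fun h hh => hIu fun v hv => ?_⟩
    have hv' : app h v = v := by
      rcases Nat.eq_zero_or_pos m with rfl | hm
      · have : Subsingleton (List (Fin 0)) := ⟨fun a b => by
          cases a with
          | nil => cases b with
            | nil => rfl
            | cons x _ => exact x.elim0
          | cons x _ => exact x.elim0⟩
        exact Subsingleton.elim _ _
      · exact levelStab_anti (Finset.le_sup (f := List.length) hv) hm hh v rfl
    rw [app_mul, hv']
    exact (hI v hv).2
  · intro H
    rw [isOpen_iff_forall_mem_open]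
    intro g hg
    obtain ⟨n, hn⟩ := H g hg
    refine ⟨⋂ v ∈ {v : List (Fin m) | v.length = n}, {f | app f v = app g v}, ?_, ?_, ?_⟩
    · intro f hf
      have := hn (g⁻¹ * f) fun v hv => by
        have hf' := Set.mem_iInter₂.1 hf v hv
        rw [app_mul, show app f v = app g v from hf', app_inv_app]
      simpa using this
    · exact (List.finite_length_eq (Fin m) n).isOpen_biInter fun v _ => isOpen_setOf_app_eq v _
    · simp

/-! ### Subgroups of the automorphism group -/

/-- `G` acts transitively on every level of the tree. -/
def LevelTransitive (G : Subgroup (TreeAut m)) : Prop :=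
  ∀ u v : List (Fin m), u.length = v.length → ∃ g ∈ G, app g u = v

/-- The rigid vertex stabilizer `rist_G(v)`: the elements of `G` that fix every vertex outside the
subtree hanging from `v`. -/
def rist (G : Subgroup (TreeAut m)) (v : List (Fin m)) : Subgroup (TreeAut m) where
  carrier := {g | g ∈ G ∧ ∀ w, ¬ v <+: w → app g w = w}
  mul_mem' := by
    rintro a b ⟨ha, ha'⟩ ⟨hb, hb'⟩
    refine ⟨G.mul_mem ha hb, fun w hw => ?_⟩
    rw [app_mul, hb' w hw, ha' w hw]
  one_mem' := ⟨G.one_mem, fun _ _ => rfl⟩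
  inv_mem' := by
    rintro a ⟨ha, ha'⟩
    refine ⟨G.inv_mem ha, fun w hw => ?_⟩
    conv_lhs => rw [← ha' w hw]
    exact app_inv_app a w

/-- The rigid level stabilizer `Rist_G(n)`: the product of the rigid stabilizers of the vertices
of level `n`. -/
def levelRist (G : Subgroup (TreeAut m)) (n : ℕ) : Subgroup (TreeAut m) :=
  ⨆ v : {v : List (Fin m) // v.length = n}, rist G v.1

/-- `G` is a branch group: it is level-transitive and its rigid level stabilizers are non-trivial
and of finite index in `G`. -/
def IsBranch (G : Subgroup (TreeAut m)) : Prop :=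
  LevelTransitive G ∧ ∀ n, levelRist G n ≠ ⊥ ∧ (levelRist G n).IsFiniteRelIndex G

/-- `Γ_m`: the automorphisms all of whose labels are powers of the cycle `σ = (1 2 ... m)`. -/
def Gamma (m : ℕ) : Subgroup (TreeAut m) where
  carrier := {g | ∀ v, ∃ τ ∈ Subgroup.zpowers (finRotate m), HasLabel g v τ}
  mul_mem' := by
    intro a b ha hb v
    obtain ⟨τ, hτ, h1⟩ := hb v
    obtain ⟨ρ, hρ, h2⟩ := ha (app b v)
    refine ⟨ρ * τ, mul_mem hρ hτ, fun x => ?_⟩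
    rw [app_mul, h1, h2, app_mul, Equiv.Perm.mul_apply]
  one_mem' := fun v => ⟨1, one_mem _, fun x => rfl⟩
  inv_mem' := by
    intro a ha v
    obtain ⟨τ, hτ, h1⟩ := ha (app a⁻¹ v)
    refine ⟨τ⁻¹, inv_mem hτ, fun x => ?_⟩
    have h2 := h1 (τ⁻¹ x)
    rw [app_app_inv, show τ (τ⁻¹ x) = x from τ.apply_symm_apply x] at h2
    rw [← h2, app_inv_app]

/-! ### Automorphisms given by their labels -/

/-- The map on words with label `P v` at the vertex `v`. -/
def portraitFun : (List (Fin m) → Equiv.Perm (Fin m)) → List (Fin m) → List (Fin m)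
  | _, [] => []
  | P, x :: w => P [] x :: portraitFun (fun u => P (x :: u)) w

/-- The inverse of `portraitFun`. -/
def portraitInv : (List (Fin m) → Equiv.Perm (Fin m)) → List (Fin m) → List (Fin m)
  | _, [] => []
  | P, y :: w => (P []).symm y :: portraitInv (fun u => P ((P []).symm y :: u)) w

theorem portraitInv_portraitFun (v : List (Fin m)) :
    ∀ P : List (Fin m) → Equiv.Perm (Fin m), portraitInv P (portraitFun P v) = v := by
  induction v with
  | nil => intro P; rfl
  | cons x w ih => intro P; simp [portraitFun, portraitInv, ih]

theorem portraitFun_portraitInv (v : List (Fin m)) :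
    ∀ P : List (Fin m) → Equiv.Perm (Fin m), portraitFun P (portraitInv P v) = v := by
  induction v with
  | nil => intro P; rfl
  | cons x w ih => intro P; simp [portraitFun, portraitInv, ih]

theorem length_portraitFun (v : List (Fin m)) :
    ∀ P : List (Fin m) → Equiv.Perm (Fin m), (portraitFun P v).length = v.length := by
  induction v with
  | nil => intro P; rfl
  | cons x w ih => intro P; simp [portraitFun, ih]

theorem portraitFun_append (v : List (Fin m)) :
    ∀ (P : List (Fin m) → Equiv.Perm (Fin m)) (u : List (Fin m)),
      portraitFun P (v ++ u) = portraitFun P v ++ portraitFun (fun s => P (v ++ s)) u := by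
  induction v with
  | nil => intro P u; rfl
  | cons x w ih => intro P u; simp [portraitFun, ih]

theorem portraitFun_prefix (u : List (Fin m)) :
    ∀ (v : List (Fin m)) (P : List (Fin m) → Equiv.Perm (Fin m)),
      u <+: v ↔ portraitFun P u <+: portraitFun P v := by
  induction u with
  | nil => intro v P; simp [portraitFun]
  | cons x w ih =>
    intro v P
    cases v with
    | nil => simp [portraitFun]
    | cons y v =>
      simp only [portraitFun, List.cons_prefix_cons, EmbeddingLike.apply_eq_iff_eq]
      constructor
      · rintro ⟨rfl, h⟩
        exact ⟨rfl, (ih _ _).1 h⟩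
      · rintro ⟨rfl, h⟩
        exact ⟨rfl, (ih _ _).2 h⟩

/-- The automorphism whose label at every vertex `v` is `P v`. -/
def ofPortrait (P : List (Fin m) → Equiv.Perm (Fin m)) : TreeAut m :=
  ⟨⟨portraitFun P, portraitInv P, fun v => portraitInv_portraitFun v P,
    fun v => portraitFun_portraitInv v P⟩,
    fun v => length_portraitFun v P, fun u v => portraitFun_prefix u v P⟩

theorem hasLabel_ofPortrait (P : List (Fin m) → Equiv.Perm (Fin m)) (v : List (Fin m)) :
    HasLabel (ofPortrait P) v (P v) := by
  intro x
  change portraitFun P (v ++ [x]) = portraitFun P v ++ [P v x]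
  rw [portraitFun_append]
  simp [portraitFun]

theorem portraitFun_eq_self (v : List (Fin m)) :
    ∀ P : List (Fin m) → Equiv.Perm (Fin m),
      (∀ u, u.length < v.length → P u = 1) → portraitFun P v = v := by
  induction v with
  | nil => intro P _; rfl
  | cons x w ih =>
    intro P h
    rw [portraitFun, h [] (by simp), ih]
    · rfl
    · intro u hu
      exact h _ (by simpa using hu)

/-! ### The groups built from staircase directed automorphisms -/

/-- The automorphism `d_i(a)`: its labels are `σ = (1 2 ... q)` at every vertex of level `i` and
trivial elsewhere. In particular `d_0(a) = a` is the rooted automorphism given by `σ`, and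
`d_i(a)` acts as `a` on each subtree hanging from a vertex of level `i`. -/
def diagRot (q i : ℕ) : TreeAut q :=
  ofPortrait fun v => if v.length = i then finRotate q else 1

/-- The sequence of levels, indexed from `0`: `staircaseLevel q n` is `l_{n+1}`, where `l_1 = 2`
and `l_{n+1} = q ^ (l_n - 1)`. -/
def staircaseLevel (q : ℕ) : ℕ → ℕ
  | 0 => 2
  | n + 1 => q ^ (staircaseLevel q n - 1)

/-- The position (counted from `0`) of a word among the words of the same length in the
lexicographical order. -/
def lexIndex {q : ℕ} (w : List (Fin q)) : ℕ :=
  w.foldl (fun k x => k * q + x) 0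

/-- The labels of the directed automorphism `b_{n+1}` (the index is shifted to start from `0`).
With `l = l_{n+1}`, the labels are trivial above level `l`; below the `j`-th vertex of level `l`
(counted from `0`) they are those of `d_j(a)` if `j < q ^ (l - 1)`, those of `b_{n+2}` if the
vertex is the last one, and trivial otherwise. The condition `0 < l` holds whenever `q ≠ 0`. -/
def staircaseLabel (q : ℕ) (n : ℕ) (v : List (Fin q)) : Equiv.Perm (Fin q) :=
  if _h : 0 < staircaseLevel q n ∧ staircaseLevel q n ≤ v.length then
    if lexIndex (v.take (staircaseLevel q n)) < q ^ (staircaseLevel q n - 1) then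
      if (v.drop (staircaseLevel q n)).length = lexIndex (v.take (staircaseLevel q n)) then
        finRotate q
      else 1
    else if lexIndex (v.take (staircaseLevel q n)) = q ^ staircaseLevel q n - 1 then
      staircaseLabel q (n + 1) (v.drop (staircaseLevel q n))
    else 1
  else 1
termination_by v.length
decreasing_by simp only [List.length_drop]; omega

/-- The staircase directed automorphism `b_{n+1}`, defined by
`ψ_l(b_{n+1}) = (d_0(a), d_1(a), ..., d_{q ^ (l - 1) - 1}(a), 1, ..., 1, b_{n+2})`
for `l = l_{n+1}`. -/
def staircase (q n : ℕ) : TreeAut q := ofPortrait (staircaseLabel q n)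

/-- The defining equation of the staircase automorphisms. -/
theorem staircase_app_append (q n : ℕ) (hl : 0 < staircaseLevel q n) (w u : List (Fin q))
    (hw : w.length = staircaseLevel q n) :
    app (staircase q n) (w ++ u) = w ++
      app (if lexIndex w < q ^ (staircaseLevel q n - 1) then diagRot q (lexIndex w)
        else if lexIndex w = q ^ staircaseLevel q n - 1 then staircase q (n + 1)
        else 1) u := by
  change portraitFun (staircaseLabel q n) (w ++ u) = _
  rw [portraitFun_append, portraitFun_eq_self w _ fun v hv => by
    rw [staircaseLabel, dif_neg (by omega)]]
  congr 1
  have key : ∀ s : List (Fin q), staircaseLabel q n (w ++ s) =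
      if lexIndex w < q ^ (staircaseLevel q n - 1) then
        if s.length = lexIndex w then finRotate q else 1
      else if lexIndex w = q ^ staircaseLevel q n - 1 then staircaseLabel q (n + 1) s
      else 1 := by
    intro s
    rw [staircaseLabel, dif_pos ⟨hl, by simp [hw]⟩, ← hw, List.take_left, List.drop_left]
  simp only [key]
  split_ifs
  · rfl
  · rfl
  · exact portraitFun_eq_self u _ fun _ _ => rfl

/-- The finite group `A_{n+1} = ⟨d_i(a) : i = 0, ..., l_{n+1} - 1⟩`. -/
def diagGroup (q n : ℕ) : Subgroup (TreeAut q) :=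
  Subgroup.closure {g | ∃ i < staircaseLevel q n, g = diagRot q i}

/-- The group `G_{n+1} = ⟨A_{n+1}, b_{n+1}⟩`. -/
def staircaseGroup (q n : ℕ) : Subgroup (TreeAut q) :=
  Subgroup.closure ((diagGroup q n : Set (TreeAut q)) ∪ {staircase q n})

/-! ### Hausdorff dimension in `Γ_m` -/

/-- The Hausdorff dimension of a subgroup of `Γ_m` with respect to the level stabilizers:
`liminf log |H St(n) : St(n)| / log |Γ_m : St(n)|`, where `St(n)` is the `n`-th level stabilizer
of `Γ_m`, so that `|H St(n) : St(n)| = |H : St_H(n)|`. -/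
noncomputable def hdim (H : Subgroup (TreeAut m)) : ℝ :=
  liminf (fun n : ℕ => Real.log ((levelStab m n).relIndex H) /
    Real.log ((levelStab m n).relIndex (Gamma m))) atTop

/-- The distance on `Γ_m` given by the level stabilizers: the infimum of `1 / |Γ_m : St(n)|` over
the `n` such that `g` and `h` agree on level `n`. -/
noncomputable def gammaDist (g h : Gamma m) : ℝ :=
  ⨅ n : {n : ℕ // ∀ v : List (Fin m), v.length = n → app g.1 v = app h.1 v},
    (((levelStab m n.1).relIndex (Gamma m) : ℝ))⁻¹

theorem relIndex_levelStab_pos (n : ℕ) (H : Subgroup (TreeAut m)) :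
    0 < (levelStab m n).relIndex H := by
  have : Finite {v : List (Fin m) // v.length = n} := List.finite_length_eq (Fin m) n
  let f : TreeAut m →* Equiv.Perm {v : List (Fin m) // v.length = n} :=
    { toFun := fun g => g.1.subtypePerm fun v => by rw [g.2.1 v]
      map_one' := rfl
      map_mul' := fun _ _ => rfl }
  have hf : f.ker ≤ levelStab m n := by
    intro g hg v hv
    exact congrArg Subtype.val (Equiv.congr_fun (MonoidHom.mem_ker.1 hg) ⟨v, hv⟩)
  have : (levelStab m n).FiniteIndex := Subgroup.finiteIndex_of_le hf
  exact Nat.pos_of_ne_zero (Subgroup.FiniteIndex.index_ne_zero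
    (H := (levelStab m n).subgroupOf H))

theorem diagRot_mem_Gamma (q i : ℕ) : diagRot q i ∈ Gamma q := by
  intro v
  refine ⟨_, ?_, hasLabel_ofPortrait _ v⟩
  split_ifs
  · exact Subgroup.mem_zpowers _
  · exact one_mem _

theorem diagRot_mem_levelStab (q i : ℕ) : diagRot q i ∈ levelStab q i := by
  intro v hv
  refine portraitFun_eq_self v _ fun u hu => ?_
  rw [if_neg (by omega)]

theorem diagRot_notMem_levelStab (hm : 2 ≤ m) (i : ℕ) : diagRot m i ∉ levelStab m (i + 1) := by
  intro h
  have hl : (List.replicate i (⟨0, by omega⟩ : Fin m)).length = i := List.length_replicate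
  have h1 := h (List.replicate i ⟨0, by omega⟩ ++ [⟨0, by omega⟩]) (by simp)
  rw [diagRot, hasLabel_ofPortrait, ← diagRot, diagRot_mem_levelStab m i _ hl] at h1
  obtain ⟨k, rfl⟩ := Nat.exists_eq_add_of_le' hm
  simp at h1

theorem relIndex_levelStab_ge (hm : 2 ≤ m) (n : ℕ) :
    n + 1 ≤ (levelStab m n).relIndex (Gamma m) := by
  induction n with
  | zero => exact relIndex_levelStab_pos 0 _
  | succ n ih =>
    have hle := levelStab_anti (m := m) (Nat.le_succ n) (by omega)
    have h1 := Subgroup.relIndex_mul_relIndex (levelStab m (n + 1) ⊓ Gamma m)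
      (levelStab m n ⊓ Gamma m) (Gamma m) (inf_le_inf_right _ hle) inf_le_right
    rw [Subgroup.inf_relIndex_right, Subgroup.inf_relIndex_right] at h1
    have h2 : (levelStab m (n + 1) ⊓ Gamma m).relIndex (levelStab m n ⊓ Gamma m) ≠ 1 := by
      intro h
      exact diagRot_notMem_levelStab hm n (Subgroup.relIndex_eq_one.1 h
        ⟨diagRot_mem_levelStab m n, diagRot_mem_Gamma m n⟩).1
    have h3 := relIndex_levelStab_pos (n + 1) (Gamma m)
    rw [← h1] at h3 ⊢
    have h4 := Nat.pos_of_mul_pos_right h3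
    have h5 : 2 ≤ (levelStab m (n + 1) ⊓ Gamma m).relIndex (levelStab m n ⊓ Gamma m) := by
      rcases Nat.eq_zero_or_pos
        ((levelStab m (n + 1) ⊓ Gamma m).relIndex (levelStab m n ⊓ Gamma m)) with h | h
      · simp [h] at h3
      · omega
    nlinarith

theorem bddBelow_gammaDist (g h : Gamma m) :
    BddBelow (Set.range fun n : {n : ℕ // ∀ v : List (Fin m), v.length = n →
      app g.1 v = app h.1 v} => (((levelStab m n.1).relIndex (Gamma m) : ℝ))⁻¹) :=
  ⟨0, by rintro _ ⟨n, rfl⟩; positivity⟩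

/-- Two automorphisms agree at level `0`. -/
theorem nonempty_agree (g h : Gamma m) :
    Nonempty {n : ℕ // ∀ v : List (Fin m), v.length = n → app g.1 v = app h.1 v} :=
  ⟨0, fun v hv => by
    rw [List.eq_nil_of_length_eq_zero ((length_app g.1 v).trans hv),
      List.eq_nil_of_length_eq_zero ((length_app h.1 v).trans hv)]⟩

theorem agree_anti (hm : 0 < m) {g h : TreeAut m} {i j : ℕ} (hij : i ≤ j)
    (H : ∀ v : List (Fin m), v.length = j → app g v = app h v) :
    ∀ v : List (Fin m), v.length = i → app g v = app h v := by
  intro v hv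
  have h1 : h⁻¹ * g ∈ levelStab m i := levelStab_anti hij hm fun w hw => by
    rw [app_mul, H w hw, app_inv_app]
  have h2 := congrArg (app h) (h1 v hv)
  rwa [app_mul, app_app_inv] at h2

theorem agree_of_gammaDist_eq_zero (hm : 2 ≤ m) {g h : Gamma m} (H : gammaDist g h = 0)
    (k : ℕ) : ∀ v : List (Fin m), v.length = k → app g.1 v = app h.1 v := by
  have := nonempty_agree g h
  have hpos : (0 : ℝ) < ((levelStab m k).relIndex (Gamma m) : ℝ)⁻¹ :=
    inv_pos.2 (Nat.cast_pos.2 (relIndex_levelStab_pos k _))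
  rw [← H] at hpos
  obtain ⟨⟨n, hn⟩, hlt⟩ := exists_lt_of_ciInf_lt hpos
  have hkn : k ≤ n := by
    by_contra hnk
    have hle := Nat.le_of_dvd (relIndex_levelStab_pos k (Gamma m))
      (Subgroup.relIndex_dvd_of_le_left (Gamma m)
        (levelStab_anti (m := m) (le_of_lt (not_le.1 hnk)) (by omega)))
    have := inv_anti₀ (Nat.cast_pos.2 (relIndex_levelStab_pos n (Gamma m)))
      (Nat.cast_le (α := ℝ).2 hle)
    exact absurd hlt (not_lt.2 this)
  exact agree_anti (by omega) hkn hn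

/-- `Γ_m` as a metric space, with the distance `gammaDist`. -/
noncomputable abbrev gammaMetric (hm : 2 ≤ m) : MetricSpace (Gamma m) where
  dist := gammaDist
  dist_self g := by
    refine le_antisymm (le_of_forall_pos_le_add fun ε hε => ?_)
      (Real.iInf_nonneg fun n => by positivity)
    obtain ⟨k, hk⟩ := exists_nat_one_div_lt hε
    refine (ciInf_le (bddBelow_gammaDist g g) ⟨k, fun _ _ => rfl⟩).trans ?_
    rw [zero_add]
    refine le_trans ?_ hk.le
    rw [one_div]
    refine inv_anti₀ (by positivity) ?_
    exact_mod_cast relIndex_levelStab_ge hm k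
  dist_comm g h := by
    have : ∀ g h : Gamma m, gammaDist g h ≤ gammaDist h g := fun g h => by
      have := nonempty_agree h g
      exact le_ciInf fun n => ciInf_le (bddBelow_gammaDist g h)
        ⟨n.1, fun v hv => (n.2 v hv).symm⟩
    exact le_antisymm (this g h) (this h g)
  dist_triangle f g h := by
    have := nonempty_agree f g
    have := nonempty_agree g h
    refine le_ciInf_add_ciInf fun i j => ?_
    have hij := ciInf_le (bddBelow_gammaDist f h) ⟨min i.1 j.1, fun v hv =>
      (agree_anti (by omega) (min_le_left _ _) i.2 v hv).trans
        (agree_anti (by omega) (min_le_right _ _) j.2 v hv)⟩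
    refine hij.trans ?_
    rcases min_choice i.1 j.1 with h | h <;> simp only [h]
    · exact le_add_of_nonneg_right (by positivity)
    · exact le_add_of_nonneg_left (by positivity)
  eq_of_dist_eq_zero {g h} H :=
    Subtype.ext (ext_app fun v => agree_of_gammaDist_eq_zero hm H v.length v rfl)

/-- The Hausdorff dimension (defined through Hausdorff measures) in the metric space `Γ_m` of the
set of elements of a subgroup. -/
noncomputable def metricHdim (hm : 2 ≤ m) (H : Subgroup (TreeAut m)) : ℝ≥0∞ :=
  @dimH (Gamma m) (@MetricSpace.toEMetricSpace _ (gammaMetric hm)) {g | g.1 ∈ H}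

end TreeAut

/-! ### Just infinite groups and pro-`p` groups -/

/-- A just infinite (discrete) group: infinite, with all proper quotients finite. -/
def IsJustInfinite (G : Type*) [Group G] : Prop :=
  Infinite G ∧ ∀ N : Subgroup G, N.Normal → N ≠ ⊥ → N.FiniteIndex

/-- A profinite group: compact, Hausdorff and totally disconnected. -/
def IsProfinite (G : Type*) [Group G] [TopologicalSpace G] : Prop :=
  IsTopologicalGroup G ∧ CompactSpace G ∧ T2Space G ∧ TotallyDisconnectedSpace G

/-- A just infinite profinite group: an infinite profinite group in which every non-trivial
closed normal subgroup is open. -/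
def IsJustInfiniteProfinite (G : Type*) [Group G] [TopologicalSpace G] : Prop :=
  IsProfinite G ∧ Infinite G ∧
    ∀ N : Subgroup G, N.Normal → IsClosed (N : Set G) → N ≠ ⊥ → IsOpen (N : Set G)

/-- A pro-`p` group: a profinite group in which every open normal subgroup has `p`-power index. -/
def IsProP (p : ℕ) (G : Type*) [Group G] [TopologicalSpace G] : Prop :=
  IsProfinite G ∧ ∀ N : Subgroup G, N.Normal → IsOpen (N : Set G) → ∃ k : ℕ, N.index = p ^ k

/-!
The theorem is deduced from a construction that applies to every `m`-adic tree. Fix `r` with `5 ≤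
m ^ r` and read the letters of a word in blocks of `r` letters. The odometer truncated at depth
`r` is a cyclic permutation of the `m ^ r` blocks all of whose labels are powers of `σ`; letting
it act on the `i`-th block gives commuting automorphisms `blockOdo m r i`, and the first `k` of
them generate a finite abelian group of exponent `m ^ r`, regular on level `r k`. A
`DirectedSystem` is a sequence of automorphisms `b_n`, fixing a level `l_n`, whose sections at
this level are elements of the abelian group `A_{n+1}`, at vertices with first block `0`, and
`b_{n+1}`, at one vertex with first block `-1`. The group under study is `G_n = ⟨A_n, b_n⟩`.

* Branching. Conjugation by `A_n` shifts the first block, and as there are at least `5` blocks one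
  can choose two elements `b (b ^ e)⁻¹` and `b ^ h (b ^ g)⁻¹` of the derived subgroup `G_n'` whose
  sections commute at all vertices of level `l_n` but one, where they are a generator of `A_{n+1}`
  and `b_{n+1}` (`DirectedSystem.commute_part`). Hence `G_n''` contains a copy of `G_{n+1}'` at
  every vertex of level `l_n` (`DirectedSystem.derived_le_comap_lift`). The generators are
  torsion, so `G_n'` has finite index, and the product of the copies of `G_{n+j}'` has finite
  index in `G_n` and lies in a rigid level stabilizer.
* Just infiniteness. A non-trivial subgroup `N` normalized by `G_n` has an element moving some
  vertex `v`, so it contains the derived subgroup of `G_{n+j}'` at `v`, hence the copies of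
  `G_{n+j+1}'` at all the vertices of a deeper level (`DirectedSystem.exists_branching_le`). This
  applies to normal subgroups of `G_n` and of its closure. For the closure one also uses that a
  closed subgroup of finite relative index in `G_n` has finite relative index in the closure.
* Hausdorff dimension. `G_n` acts on level `l_n` as the abelian group `A_n`, so that at the level
  `N + l_{n+j}`, where `N = l_n + ... + l_{n+j-1}`, the logarithm to base `m` of the index of the
  level stabilizer is at most `m ^ N (1 + l_{n+j})`; for `Γ_m` it is at least `m ^ (N + l_{n+j} -
  1)`. The ratio tends to `0` as `l_n` tends to infinity, which gives both kinds of dimension.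

The staircase groups form a directed system with `r = 1` (`staircaseSystem`). For the first part,
where `p` may be `2` or `3`, blocks of three letters are used (`threeLetterSystem`): the tree is
still `p`-adic but `p ^ 3 ≥ 5`.
-/

open scoped commutatorElement

/-! ### Sections and automorphisms supported on a subtree -/

namespace TreeAut

variable {m : ℕ}

theorem app_prefix_app (g : TreeAut m) {u v : List (Fin m)} : app g u <+: app g v ↔ u <+: v :=
  (g.2.2 u v).symm

theorem app_append_eq_drop (g : TreeAut m) (v u : List (Fin m)) :
    app g (v ++ u) = app g v ++ (app g (v ++ u)).drop v.length := by
  have h := List.prefix_iff_eq_take.1 ((app_prefix_app g).2 (List.prefix_append v u))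
  rw [length_app] at h
  conv_lhs => rw [← List.take_append_drop v.length (app g (v ++ u)), ← h]

/-- A tree automorphism from a pair of mutually inverse maps preserving length and prefixes. -/
def ofMaps (f f' : List (Fin m) → List (Fin m)) (h : ∀ v, f' (f v) = v) (h' : ∀ v, f (f' v) = v)
    (hl : ∀ v, (f v).length = v.length) (hp : ∀ u v, u <+: v → f u <+: f v)
    (hp' : ∀ u v, u <+: v → f' u <+: f' v) : TreeAut m :=
  ⟨⟨f, f', h, h'⟩, hl, fun u v => ⟨hp u v, fun H => by
    have H' : f' (f u) <+: f' (f v) := hp' _ _ H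
    rwa [h u, h v] at H'⟩⟩

/-- The section of `g` at the vertex `v`: the automorphism `s` with `g (v u) = g (v) s (u)`. -/
def sec (g : TreeAut m) (v : List (Fin m)) : TreeAut m :=
  ofMaps (fun u => (app g (v ++ u)).drop v.length) (fun u => (app g⁻¹ (app g v ++ u)).drop v.length)
    (fun u => by
      rw [← app_append_eq_drop, app_inv_app, List.drop_left])
    (fun u => by
      have h := app_append_eq_drop g⁻¹ (app g v) u
      rw [app_inv_app, length_app] at h
      rw [← h, app_app_inv, ← length_app g v, List.drop_left])
    (fun u => by simp [length_app])
    (fun u w h => by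
      have := (app_prefix_app g).2 ((List.prefix_append_right_inj v).2 h)
      exact this.drop _)
    (fun u w h => by
      have := (app_prefix_app g⁻¹).2 ((List.prefix_append_right_inj (app g v)).2 h)
      exact this.drop _)

theorem app_sec (g : TreeAut m) (v u : List (Fin m)) :
    app (sec g v) u = (app g (v ++ u)).drop v.length := rfl

theorem app_append (g : TreeAut m) (v u : List (Fin m)) :
    app g (v ++ u) = app g v ++ app (sec g v) u :=
  app_append_eq_drop g v u

theorem sec_eq_of_forall {g h : TreeAut m} {v w : List (Fin m)} (hw : w.length = v.length)
    (H : ∀ u, app g (v ++ u) = w ++ app h u) : sec g v = h :=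
  ext_app fun u => by rw [app_sec, H, ← hw, List.drop_left]

theorem sec_mul (g h : TreeAut m) (v : List (Fin m)) :
    sec (g * h) v = sec g (app h v) * sec h v :=
  sec_eq_of_forall (w := app g (app h v)) (by simp [length_app]) fun u => by
    rw [app_mul, app_append, app_append, app_mul]

@[simp]
theorem sec_one (v : List (Fin m)) : sec (1 : TreeAut m) v = 1 :=
  sec_eq_of_forall (w := v) rfl fun _ => rfl

theorem sec_inv (g : TreeAut m) (v : List (Fin m)) : sec g⁻¹ v = (sec g (app g⁻¹ v))⁻¹ := by
  rw [eq_inv_iff_mul_eq_one]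
  have h := sec_mul g g⁻¹ v
  rw [mul_inv_cancel, sec_one] at h
  exact mul_eq_one_comm.1 h.symm

theorem sec_append (g : TreeAut m) (v w : List (Fin m)) : sec g (v ++ w) = sec (sec g v) w :=
  sec_eq_of_forall (w := app g v ++ app (sec g v) w) (by simp [length_app]) fun u => by
    rw [List.append_assoc, app_append, app_append, List.append_assoc]

@[simp]
theorem sec_nil (g : TreeAut m) : sec g [] = g :=
  ext_app fun u => by rw [app_sec]; rfl

theorem app_nil (g : TreeAut m) : app g [] = [] :=
  List.eq_nil_of_length_eq_zero (length_app g [])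

/-- Automorphisms are determined by their action on long words. -/
theorem ext_of_long (hm : 0 < m) {g h : TreeAut m} (N : ℕ)
    (H : ∀ v w : List (Fin m), v.length = N → app g (v ++ w) = app h (v ++ w)) : g = h := by
  refine ext_app fun u => ?_
  refine agree_anti hm (Nat.le_add_right u.length N) (fun v hv => ?_) u rfl
  rw [← List.take_append_drop N v]
  exact H _ _ (by simp [hv])

theorem levelStab_ext (hm : 0 < m) {N : ℕ} {g h : TreeAut m} (hg : g ∈ levelStab m N)
    (hh : h ∈ levelStab m N) (H : ∀ v : List (Fin m), v.length = N → sec g v = sec h v) : g = h :=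
  ext_of_long hm N fun v w hv => by rw [app_append, app_append, hg v hv, hh v hv, H v hv]

theorem sec_mul_of_mem {N : ℕ} (g : TreeAut m) {h : TreeAut m} (hh : h ∈ levelStab m N)
    {v : List (Fin m)} (hv : v.length = N) : sec (g * h) v = sec g v * sec h v := by
  rw [sec_mul, hh v hv]

theorem sec_inv_of_mem {N : ℕ} {g : TreeAut m} (hg : g ∈ levelStab m N)
    {v : List (Fin m)} (hv : v.length = N) : sec g⁻¹ v = (sec g v)⁻¹ := by
  rw [sec_inv, (levelStab m N).inv_mem hg v hv]

instance levelStab_normal (N : ℕ) : (levelStab m N).Normal :=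
  ⟨fun g hg h v hv => by
    rw [app_mul, app_mul, hg _ ((length_app h⁻¹ v).trans hv), app_app_inv]⟩

/-- The action of `lift v g` on words. -/
def liftFun (v : List (Fin m)) (g : TreeAut m) (w : List (Fin m)) : List (Fin m) :=
  if v <+: w then v ++ app g (w.drop v.length) else w

theorem liftFun_append (v : List (Fin m)) (g : TreeAut m) (u : List (Fin m)) :
    liftFun v g (v ++ u) = v ++ app g u := by
  rw [liftFun, if_pos (List.prefix_append v u), List.drop_left]

theorem liftFun_mul (v : List (Fin m)) (g h : TreeAut m) (w : List (Fin m)) :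
    liftFun v g (liftFun v h w) = liftFun v (g * h) w := by
  by_cases hw : v <+: w
  · obtain ⟨u, rfl⟩ := hw
    rw [liftFun_append, liftFun_append, liftFun_append, app_mul]
  · simp [liftFun, hw]

theorem liftFun_one (v w : List (Fin m)) : liftFun v 1 w = w := by
  by_cases hw : v <+: w
  · obtain ⟨u, rfl⟩ := hw
    rw [liftFun_append, app_one]
  · simp [liftFun, hw]

theorem liftFun_prefix (v : List (Fin m)) (g : TreeAut m) (u w : List (Fin m)) (h : u <+: w) :
    liftFun v g u <+: liftFun v g w := by
  by_cases hu : v <+: u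
  · obtain ⟨u, rfl⟩ := hu
    obtain ⟨s, rfl⟩ := h
    rw [List.append_assoc, liftFun_append, liftFun_append, List.prefix_append_right_inj,
      app_prefix_app]
    exact List.prefix_append _ _
  · rw [liftFun, if_neg hu]
    by_cases hw : v <+: w
    · have h1 : u <+: v := (List.prefix_or_prefix_of_prefix h hw).resolve_right hu
      obtain ⟨w, rfl⟩ := hw
      rw [liftFun_append]
      exact h1.trans (List.prefix_append _ _)
    · rwa [liftFun, if_neg hw]

/-- The automorphism `lift v g` acts as `g` on the subtree hanging from `v` and fixes every vertex
outside it. -/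
def lift (v : List (Fin m)) : TreeAut m →* TreeAut m where
  toFun g := ofMaps (liftFun v g) (liftFun v g⁻¹)
    (fun w => by rw [liftFun_mul, inv_mul_cancel, liftFun_one])
    (fun w => by rw [liftFun_mul, mul_inv_cancel, liftFun_one])
    (fun w => by
      by_cases hw : v <+: w
      · obtain ⟨u, rfl⟩ := hw
        simp [liftFun_append, length_app]
      · rw [liftFun, if_neg hw])
    (liftFun_prefix v g) (liftFun_prefix v g⁻¹)
  map_one' := ext_app fun w => liftFun_one v w
  map_mul' g h := ext_app fun w => (liftFun_mul v g h w).symm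

theorem app_lift_append (v : List (Fin m)) (g : TreeAut m) (u : List (Fin m)) :
    app (lift v g) (v ++ u) = v ++ app g u := liftFun_append v g u

theorem app_lift_of_not_prefix {v w : List (Fin m)} (g : TreeAut m) (h : ¬ v <+: w) :
    app (lift v g) w = w := if_neg h

theorem sec_lift_self (v : List (Fin m)) (g : TreeAut m) : sec (lift v g) v = g :=
  sec_eq_of_forall (w := v) rfl (app_lift_append v g)

theorem sec_lift_of_ne {v w : List (Fin m)} (g : TreeAut m) (hl : w.length = v.length)
    (h : w ≠ v) : sec (lift v g) w = 1 :=
  sec_eq_of_forall (w := w) rfl fun _ => app_lift_of_not_prefix g fun H =>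
    h ((List.prefix_of_prefix_length_le H (List.prefix_append _ _) hl.ge).eq_of_length hl.symm).symm

theorem lift_mem_levelStab (v : List (Fin m)) (g : TreeAut m) :
    lift v g ∈ levelStab m v.length := by
  intro w hw
  by_cases h : v <+: w
  · obtain rfl := h.eq_of_length hw.symm
    simpa [app_nil] using app_lift_append v g []
  · exact app_lift_of_not_prefix g h

theorem lift_append (v w : List (Fin m)) (g : TreeAut m) :
    lift (v ++ w) g = lift v (lift w g) := by
  refine ext_app fun u => ?_
  by_cases h : v <+: u
  · obtain ⟨u, rfl⟩ := h
    rw [app_lift_append]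
    by_cases h' : w <+: u
    · obtain ⟨u, rfl⟩ := h'
      rw [app_lift_append, ← List.append_assoc, app_lift_append, List.append_assoc]
    · rw [app_lift_of_not_prefix _ h', app_lift_of_not_prefix]
      rwa [List.prefix_append_right_inj]
  · rw [app_lift_of_not_prefix _ h, app_lift_of_not_prefix]
    exact fun H => h ((List.prefix_append v w).trans H)

theorem conj_lift (h : TreeAut m) (v : List (Fin m)) (g : TreeAut m) :
    h * lift v g * h⁻¹ = lift (app h v) (sec h v * g * (sec h v)⁻¹) := by
  rw [mul_inv_eq_iff_eq_mul]
  refine ext_app fun w => ?_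
  rw [app_mul, app_mul]
  by_cases hw : v <+: w
  · obtain ⟨u, rfl⟩ := hw
    rw [app_lift_append, app_append, app_append, app_lift_append, app_mul, app_mul, app_inv_app]
  · rw [app_lift_of_not_prefix _ hw, app_lift_of_not_prefix]
    rwa [app_prefix_app]

/-! ### Products of subgroups over the vertices of a level -/

/-- The product, over the vertices `v` of level `N`, of the subgroups `F v` acting on the subtrees
hanging from these vertices. -/
def levelProd (N : ℕ) (F : List (Fin m) → Subgroup (TreeAut m)) : Subgroup (TreeAut m) where
  carrier := {g | g ∈ levelStab m N ∧ ∀ v, v.length = N → sec g v ∈ F v}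
  mul_mem' := by
    rintro a b ⟨ha, ha'⟩ ⟨hb, hb'⟩
    refine ⟨mul_mem ha hb, fun v hv => ?_⟩
    rw [sec_mul_of_mem _ hb hv]
    exact mul_mem (ha' v hv) (hb' v hv)
  one_mem' := ⟨one_mem _, fun v _ => by simp [one_mem]⟩
  inv_mem' := by
    rintro a ⟨ha, ha'⟩
    refine ⟨inv_mem ha, fun v hv => ?_⟩
    rw [sec_inv_of_mem ha hv]
    exact inv_mem (ha' v hv)

/-- An automorphism fixing a level is the product of its parts on the subtrees hanging from the
vertices of this level. -/
theorem mem_of_forall_lift_sec_mem (hm : 0 < m) {N : ℕ} {H : Subgroup (TreeAut m)} {g : TreeAut m}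
    (hg : g ∈ levelStab m N) (h : ∀ v, v.length = N → lift v (sec g v) ∈ H) : g ∈ H := by
  classical
  have key : ∀ (T : Finset (List (Fin m))) (g : TreeAut m), g ∈ levelStab m N →
      (∀ v ∈ T, v.length = N) → (∀ v, v.length = N → lift v (sec g v) ∈ H) →
      (∀ v, v.length = N → v ∉ T → sec g v = 1) → g ∈ H := by
    intro T
    induction T using Finset.induction_on with
    | empty =>
      intro g hg _ _ h1
      rw [levelStab_ext hm hg (one_mem _) fun v hv => by rw [h1 v hv (by simp), sec_one]]
      exact one_mem _
    | insert a T ha ih =>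
      intro g hg hT hH h1
      have haN : a.length = N := hT a (Finset.mem_insert_self _ _)
      have hmem : lift a (sec g a)⁻¹ ∈ levelStab m N := haN ▸ lift_mem_levelStab a _
      have hsec : ∀ v, v.length = N → sec (g * lift a (sec g a)⁻¹) v =
          if v = a then 1 else sec g v := by
        intro v hv
        rw [sec_mul_of_mem _ hmem hv]
        split_ifs with hva
        · rw [hva, sec_lift_self, mul_inv_cancel]
        · rw [sec_lift_of_ne _ (hv.trans haN.symm) hva, mul_one]
      have h2 : g * lift a (sec g a)⁻¹ ∈ H := by
        refine ih _ (mul_mem hg hmem) (fun v hv => hT v (Finset.mem_insert_of_mem hv))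
          (fun v hv => ?_) (fun v hv hvT => ?_)
        · rw [hsec v hv]
          split_ifs
          · simp [one_mem]
          · exact hH v hv
        · rw [hsec v hv]
          split_ifs with hva
          · rfl
          · exact h1 v hv (by simp [hva, hvT])
      rw [map_inv] at h2
      have := mul_mem h2 (hH a haN)
      rwa [inv_mul_cancel_right] at this
  exact key (List.finite_length_eq (Fin m) N).toFinset g hg (by simp) h (by simp +contextual)

theorem levelProd_le (hm : 0 < m) {N : ℕ} {F : List (Fin m) → Subgroup (TreeAut m)}
    {H : Subgroup (TreeAut m)} (h : ∀ v, v.length = N → F v ≤ H.comap (lift v)) :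
    levelProd N F ≤ H := fun _ hg =>
  mem_of_forall_lift_sec_mem hm hg.1 fun v hv => h v hv (hg.2 v hv)

theorem lift_mem_rist {G : Subgroup (TreeAut m)} {v : List (Fin m)} {g : TreeAut m}
    (h : lift v g ∈ G) : lift v g ∈ rist G v :=
  ⟨h, fun _ hw => app_lift_of_not_prefix g hw⟩

theorem levelProd_le_levelRist (hm : 0 < m) {N : ℕ} {F : List (Fin m) → Subgroup (TreeAut m)}
    {G : Subgroup (TreeAut m)} (h : ∀ v, v.length = N → F v ≤ G.comap (lift v)) :
    levelProd N F ≤ levelRist G N :=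
  levelProd_le hm fun v hv _ hg =>
    (le_iSup (fun v : {v : List (Fin m) // v.length = N} => rist G v.1) ⟨v, hv⟩)
      (lift_mem_rist (h v hv hg))

theorem rist_anti (G : Subgroup (TreeAut m)) {v w : List (Fin m)} (h : v <+: w) :
    rist G w ≤ rist G v := fun _ hg => ⟨hg.1, fun u hu => hg.2 u fun H => hu (h.trans H)⟩

theorem levelRist_anti (G : Subgroup (TreeAut m)) {i j : ℕ} (hij : i ≤ j) :
    levelRist G j ≤ levelRist G i :=
  iSup_le fun v => (rist_anti G (List.take_prefix i v.1)).trans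
    (le_iSup (fun v : {v : List (Fin m) // v.length = i} => rist G v.1)
      ⟨v.1.take i, by simp [v.2, hij]⟩)

end TreeAut

/-! ### Topology of the automorphism group -/

namespace TreeAut

variable {m : ℕ}

theorem isClosed_setOf_app_eq (v w : List (Fin m)) : IsClosed {g : TreeAut m | app g v = w} := by
  rw [← isOpen_compl_iff]
  have : {g : TreeAut m | app g v = w}ᶜ = ⋃ u ∈ {u | u ≠ w}, {g : TreeAut m | app g v = u} := by
    ext g
    simp
  rw [this]
  exact isOpen_biUnion fun u _ => isOpen_setOf_app_eq v u

theorem isClosed_levelStab (N : ℕ) : IsClosed (levelStab m N : Set (TreeAut m)) := by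
  have : (levelStab m N : Set (TreeAut m)) =
      ⋂ v ∈ {v : List (Fin m) | v.length = N}, {g : TreeAut m | app g v = v} := by
    ext g
    simp only [Set.mem_iInter]
    exact Iff.rfl
  rw [this]
  exact isClosed_biInter fun v _ => isClosed_setOf_app_eq v v

theorem isOpen_levelStab (N : ℕ) : IsOpen (levelStab m N : Set (TreeAut m)) :=
  (isOpen_iff_levelStab _).2 fun _ hg => ⟨N, fun _ hh => mul_mem hg hh⟩

theorem continuous_sec (v : List (Fin m)) : Continuous fun g : TreeAut m => sec g v := by
  refine continuous_of_app _ fun u w => ?_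
  have : {g : TreeAut m | app (sec g v) u = w} =
      ⋃ s ∈ {s : List (Fin m) | s.drop v.length = w}, {g : TreeAut m | app g (v ++ u) = s} := by
    ext g
    simp [app_sec]
  rw [this]
  exact isOpen_biUnion fun s _ => isOpen_setOf_app_eq _ s

theorem continuous_lift (v : List (Fin m)) : Continuous (lift v) := by
  refine continuous_of_app _ fun u w => ?_
  by_cases hu : v <+: u
  · obtain ⟨u, rfl⟩ := hu
    have : {g : TreeAut m | app (lift v g) (v ++ u) = w} =
        ⋃ s ∈ {s : List (Fin m) | v ++ s = w}, {g : TreeAut m | app g u = s} := by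
      ext g
      simp [app_lift_append]
    rw [this]
    exact isOpen_biUnion fun s _ => isOpen_setOf_app_eq _ s
  · simp only [app_lift_of_not_prefix _ hu]
    exact isOpen_const

theorem isClosed_levelProd (N : ℕ) {F : List (Fin m) → Subgroup (TreeAut m)}
    (hF : ∀ v, IsClosed (F v : Set (TreeAut m))) :
    IsClosed (levelProd N F : Set (TreeAut m)) := by
  have : (levelProd N F : Set (TreeAut m)) = (levelStab m N : Set (TreeAut m)) ∩
      ⋂ v ∈ {v : List (Fin m) | v.length = N}, (fun g => sec g v) ⁻¹' (F v : Set (TreeAut m)) := by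
    ext g
    simp [levelProd]
  rw [this]
  exact (isClosed_levelStab N).inter
    (isClosed_biInter fun v _ => (hF v).preimage (continuous_sec v))

theorem isClosed_Gamma : IsClosed (Gamma m : Set (TreeAut m)) := by
  have : (Gamma m : Set (TreeAut m)) = ⋂ v, ⋃ τ ∈ {τ | τ ∈ Subgroup.zpowers (finRotate m)},
      ⋂ x, ⋃ w ∈ {w | w.length = v.length}, {g : TreeAut m | app g v = w} ∩
        {g : TreeAut m | app g (v ++ [x]) = w ++ [τ x]} := by
    ext g
    simp [Gamma, HasLabel, length_app]
  rw [this]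
  exact isClosed_iInter fun v => (Set.toFinite _).isClosed_biUnion fun τ _ =>
    isClosed_iInter fun x => (List.finite_length_eq (Fin m) v.length).isClosed_biUnion fun w _ =>
      (isClosed_setOf_app_eq _ _).inter (isClosed_setOf_app_eq _ _)

theorem bijective_of_length_of_prefix {f : List (Fin m) → List (Fin m)}
    (hl : ∀ v, (f v).length = v.length) (hp : ∀ u v, u <+: v ↔ f u <+: f v) :
    Function.Bijective f := by
  have hinj : Function.Injective f := fun u v h => by
    have h1 := (hp u v).2 (h ▸ List.prefix_refl _)
    exact h1.eq_of_length (by rw [← hl u, ← hl v, h])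
  refine ⟨hinj, fun w => ?_⟩
  have hfin : Finite {v : List (Fin m) // v.length = w.length} :=
    List.finite_length_eq (Fin m) w.length
  have hs := Finite.surjective_of_injective (α := {v : List (Fin m) // v.length = w.length})
    (f := fun v => ⟨f v.1, (hl v.1).trans v.2⟩)
    fun u v h => Subtype.ext (hinj (congrArg Subtype.val h))
  obtain ⟨v, hv⟩ := hs ⟨w, rfl⟩
  exact ⟨v.1, congrArg Subtype.val hv⟩

instance : T2Space (TreeAut m) := by
  refine ⟨fun g h hgh => ?_⟩
  obtain ⟨v, hv⟩ : ∃ v, app g v ≠ app h v := by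
    by_contra! H
    exact hgh (ext_app H)
  exact ⟨_, _, isOpen_setOf_app_eq v (app g v), isOpen_setOf_app_eq v (app h v), rfl, rfl,
    Set.disjoint_left.2 fun f hf hf' => hv (hf.symm.trans hf')⟩

instance : TotallyDisconnectedSpace (TreeAut m) := by
  refine ⟨fun t _ ht g hg h hh => ext_app fun v => ?_⟩
  exact (ht.subset_isClopen ⟨isClosed_setOf_app_eq v (app g v), isOpen_setOf_app_eq v (app g v)⟩
    ⟨g, hg, rfl⟩ hh).symm

/-- The image of `TreeAut m` in the product `∏ v, List (Fin m)` is a closed subset of the compact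
product of the levels. -/
instance : CompactSpace (TreeAut m) := by
  let _ : TopologicalSpace (List (Fin m)) := ⊥
  have _ : DiscreteTopology (List (Fin m)) := ⟨rfl⟩
  have hi : IsInducing (app : TreeAut m → List (Fin m) → List (Fin m)) := ⟨rfl⟩
  have hK : IsCompact (Set.pi Set.univ fun v : List (Fin m) =>
      {w : List (Fin m) | w.length = v.length}) :=
    isCompact_univ_pi fun v => (List.finite_length_eq (Fin m) v.length).isCompact
  have hC : IsClosed {f : List (Fin m) → List (Fin m) | ∀ u v, u <+: v ↔ f u <+: f v} := by
    simp only [Set.ofPred_forall]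
    refine isClosed_iInter fun u => isClosed_iInter fun v => ?_
    have h := isClosed_discrete {x : List (Fin m) × List (Fin m) | u <+: v ↔ x.1 <+: x.2}
    have hc : Continuous fun f : List (Fin m) → List (Fin m) => (f u, f v) :=
      (continuous_apply u).prodMk (continuous_apply v)
    exact h.preimage hc
  rw [← isCompact_univ_iff, hi.isCompact_iff]
  convert hK.inter_right hC
  ext f
  simp only [Set.image_univ, Set.mem_range, Set.mem_inter_iff, Set.mem_pi, Set.mem_univ,
    true_implies, Set.mem_ofPred_eq]
  constructor
  · rintro ⟨g, rfl⟩
    exact g.2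
  · rintro ⟨hl, hp⟩
    exact ⟨⟨Equiv.ofBijective f (bijective_of_length_of_prefix hl hp), hl, hp⟩, rfl⟩

theorem isProfinite_of_isClosed {H : Subgroup (TreeAut m)} (hH : IsClosed (H : Set (TreeAut m))) :
    IsProfinite H :=
  ⟨inferInstance, isCompact_iff_compactSpace.1 hH.isCompact, inferInstance, inferInstance⟩

theorem exists_levelStab_subgroupOf_le {H : Subgroup (TreeAut m)} {N : Subgroup H}
    (hN : IsOpen (N : Set H)) : ∃ n, (levelStab m n).subgroupOf H ≤ N := by
  obtain ⟨U, hU, hUN⟩ := isOpen_induced_iff.1 hN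
  have h1 : (1 : TreeAut m) ∈ U := by
    have : (1 : H) ∈ Subtype.val ⁻¹' U := by
      rw [hUN]
      exact N.one_mem
    exact this
  obtain ⟨n, hn⟩ := (isOpen_iff_levelStab U).1 hU 1 h1
  refine ⟨n, fun h hh => ?_⟩
  have h2 := hn h.1 hh
  rw [one_mul] at h2
  have : h ∈ Subtype.val ⁻¹' U := h2
  rwa [hUN] at this

instance (n : ℕ) (H : Subgroup (TreeAut m)) : ((levelStab m n).subgroupOf H).FiniteIndex :=
  ⟨(relIndex_levelStab_pos n H).ne'⟩

theorem pow_mem_levelStab_succ {g : TreeAut m} (hg : g ∈ Gamma m) {n : ℕ}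
    (hn : g ∈ levelStab m n) : g ^ m ∈ levelStab m (n + 1) := by
  intro w hw
  obtain ⟨v, x, rfl⟩ : ∃ v x, w = v ++ [x] :=
    ⟨w.dropLast, w.getLast (by rintro rfl; simp at hw), (List.dropLast_append_getLast _).symm⟩
  have hv : v.length = n := by simpa using hw
  obtain ⟨τ, ⟨c, rfl⟩, hτ⟩ := hg v
  have key : ∀ j : ℕ, app (g ^ j) (v ++ [x]) = v ++ [((finRotate m ^ c) ^ j) x] := by
    intro j
    induction j with
    | zero => rfl
    | succ j ih =>
      rw [pow_succ', app_mul, ih, hτ, hn v hv, pow_succ', Equiv.Perm.mul_apply]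
  rw [key]
  congr
  obtain rfl | hm1 : m = 1 ∨ 2 ≤ m := by
    have := x.pos
    omega
  · exact Subsingleton.elim _ _
  · obtain ⟨d, rfl⟩ := Nat.exists_eq_add_of_le' hm1
    have h1 : finRotate (d + 2) ^ (d + 2) = 1 := by
      have h := pow_orderOf_eq_one (finRotate (d + 2))
      rwa [isCycle_finRotate.orderOf, support_finRotate, Finset.card_univ, Fintype.card_fin] at h
    rw [← zpow_natCast, ← zpow_mul, mul_comm, zpow_mul, zpow_natCast, h1, one_zpow]
    rfl

theorem pow_pow_mem_levelStab {g : TreeAut m} (hg : g ∈ Gamma m) (n : ℕ) :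
    g ^ m ^ n ∈ levelStab m n := by
  induction n with
  | zero =>
    intro v hv
    rw [List.eq_nil_of_length_eq_zero hv, app_nil]
  | succ n ih =>
    rw [pow_succ, pow_mul]
    exact pow_mem_levelStab_succ (pow_mem hg _) ih

theorem isProP_of_isClosed {p j : ℕ} (hp : p.Prime) (hm : m = p ^ j) {H : Subgroup (TreeAut m)}
    (hH : IsClosed (H : Set (TreeAut m))) (hΓ : H ≤ Gamma m) : IsProP p H := by
  refine ⟨isProfinite_of_isClosed hH, fun N hN hNo => ?_⟩
  obtain ⟨n, hn⟩ := exists_levelStab_subgroupOf_le hNo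
  have : N.FiniteIndex := Subgroup.finiteIndex_of_le hn
  have : Fact p.Prime := ⟨hp⟩
  have hP : IsPGroup p (H ⧸ N) := by
    intro x
    obtain ⟨h, rfl⟩ := QuotientGroup.mk_surjective x
    refine ⟨j * n, ?_⟩
    rw [← QuotientGroup.mk_pow, QuotientGroup.eq_one_iff]
    refine hn ?_
    rw [pow_mul, ← hm]
    exact pow_pow_mem_levelStab (hΓ h.2) n
  exact IsPGroup.iff_card.1 hP

/-- A closed subgroup that has finite relative index in `G` has finite relative index in the
closure of `G`. -/
theorem relIndex_topologicalClosure_ne_zero {M G : Subgroup (TreeAut m)}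
    (hM : IsClosed (M : Set (TreeAut m))) (h : M.relIndex G ≠ 0) :
    M.relIndex G.topologicalClosure ≠ 0 := by
  have hF : (M.subgroupOf G).FiniteIndex := ⟨h⟩
  have hfin : Finite (G ⧸ M.subgroupOf G) := inferInstance
  have hcl : IsClosed (⋃ x : G ⧸ M.subgroupOf G, (fun g => (x.out : TreeAut m)⁻¹ * g) ⁻¹'
      (M : Set (TreeAut m))) :=
    isClosed_iUnion_of_finite fun x => hM.preimage (continuous_const_mul _)
  have hsub : (G.topologicalClosure : Set (TreeAut m)) ⊆ _ :=
    closure_minimal (fun g hg => ?_) hcl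
  · have : Finite (G.topologicalClosure ⧸ M.subgroupOf G.topologicalClosure) := by
      refine Finite.of_surjective (fun x : G ⧸ M.subgroupOf G => QuotientGroup.mk
        ⟨x.out, G.le_topologicalClosure x.out.2⟩) fun y => ?_
      obtain ⟨y, rfl⟩ := QuotientGroup.mk_surjective y
      obtain ⟨x, hx⟩ := Set.mem_iUnion.1 (hsub y.2)
      exact ⟨x, QuotientGroup.eq.2 hx⟩
    exact (Subgroup.finiteIndex_of_finite_quotient
      (H := M.subgroupOf G.topologicalClosure)).index_ne_zero
  · have h1 : (((QuotientGroup.mk ⟨g, hg⟩ : G ⧸ M.subgroupOf G).out : G)⁻¹ * ⟨g, hg⟩ : G) ∈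
        M.subgroupOf G := QuotientGroup.eq.1 (QuotientGroup.out_eq' _)
    exact Set.mem_iUnion.2 ⟨QuotientGroup.mk ⟨g, hg⟩, h1⟩

/-! ### Indices of level stabilizers -/

theorem relIndex_levelStab_le {α : Type*} [Finite α] {n : ℕ} {H : Subgroup (TreeAut m)}
    (f : H → α)
    (hf : ∀ g h : H, f g = f h → ∀ v : List (Fin m), v.length = n → app g.1 v = app h.1 v) :
    (levelStab m n).relIndex H ≤ Nat.card α := by
  refine Nat.card_le_card_of_injective
    (fun x : H ⧸ (levelStab m n).subgroupOf H => f x.out) fun x y hxy => ?_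
  rw [← QuotientGroup.out_eq' x, ← QuotientGroup.out_eq' y, QuotientGroup.eq]
  intro v hv
  change app ((x.out : TreeAut m)⁻¹ * (y.out : TreeAut m)) v = v
  rw [app_mul, ← hf _ _ hxy v hv, app_inv_app]

theorem le_relIndex_levelStab {α : Type*} {n : ℕ} {H : Subgroup (TreeAut m)}
    (f : α → H)
    (hf : ∀ a b, (∀ v : List (Fin m), v.length = n → app (f a).1 v = app (f b).1 v) → a = b) :
    Nat.card α ≤ (levelStab m n).relIndex H := by
  refine Nat.card_le_card_of_injective
    (β := H ⧸ (levelStab m n).subgroupOf H) (fun a => QuotientGroup.mk (f a)) fun a b hab => ?_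
  refine hf a b fun v hv => ?_
  have h := QuotientGroup.eq.1 hab v hv
  have h2 := congrArg (app (f a).1) h
  rw [← app_mul] at h2
  rw [← h2]
  simp [app]

theorem card_level (m n : ℕ) : Nat.card {v : List (Fin m) // v.length = n} = m ^ n := by
  have := card_vector (α := Fin m) n
  rw [Fintype.card_fin] at this
  rw [← this, ← Nat.card_eq_fintype_card]
  rfl

instance (n : ℕ) : Finite {v : List (Fin m) // v.length = n} := List.finite_length_eq (Fin m) n

theorem agree_of_inv_mul_mem {n : ℕ} {g h : TreeAut m} (H : g⁻¹ * h ∈ levelStab m n)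
    {v : List (Fin m)} (hv : v.length = n) : app g v = app h v := by
  have h2 := congrArg (app g) (H v hv)
  rw [app_mul, app_app_inv] at h2
  exact h2.symm

theorem agree_of_mk_eq {n : ℕ} {H : Subgroup (TreeAut m)} {g h : H}
    (e : (QuotientGroup.mk g : H ⧸ (levelStab m n).subgroupOf H) = QuotientGroup.mk h)
    {v : List (Fin m)} (hv : v.length = n) : app g.1 v = app h.1 v := by
  have h1 : g⁻¹ * h ∈ (levelStab m n).subgroupOf H := QuotientGroup.eq.1 e
  exact agree_of_inv_mul_mem h1 hv

theorem relIndex_levelStab_add_le {N M : ℕ} {H K : Subgroup (TreeAut m)}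
    (h : ∀ g ∈ H, ∀ v : List (Fin m), v.length = N → sec g v ∈ K) :
    (levelStab m (N + M)).relIndex H ≤
      (levelStab m N).relIndex H * (levelStab m M).relIndex K ^ m ^ N := by
  have h1 := relIndex_levelStab_le (n := N + M) (H := H)
    (α := (H ⧸ (levelStab m N).subgroupOf H) ×
      ({v : List (Fin m) // v.length = N} → K ⧸ (levelStab m M).subgroupOf K))
    (fun g => (QuotientGroup.mk g, fun v => QuotientGroup.mk ⟨sec g.1 v.1, h g.1 g.2 v.1 v.2⟩))
    (fun g g' hgg w hw => by
      rw [Prod.mk.injEq] at hgg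
      have hN : (w.take N).length = N := by simp [hw]
      have h2 := agree_of_mk_eq hgg.1 hN
      have h3 := agree_of_mk_eq (v := w.drop N) (congrFun hgg.2 ⟨w.take N, hN⟩) (by simp [hw])
      rw [← List.take_append_drop N w, app_append, app_append, h2]
      exact congrArg _ h3)
  rwa [Nat.card_prod, Nat.card_fun, card_level] at h1

theorem sec_mem_Gamma {g : TreeAut m} (hg : g ∈ Gamma m) (v : List (Fin m)) :
    sec g v ∈ Gamma m := by
  intro w
  obtain ⟨τ, hτ, h⟩ := hg (v ++ w)
  refine ⟨τ, hτ, fun x => ?_⟩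
  have h1 := h x
  rw [List.append_assoc, app_append, app_append g v w, List.append_assoc] at h1
  exact List.append_cancel_left h1

theorem card_zpowers_finRotate (hm : 2 ≤ m) :
    Nat.card (Subgroup.zpowers (finRotate m)) = m := by
  obtain ⟨d, rfl⟩ := Nat.exists_eq_add_of_le' hm
  rw [Nat.card_zpowers, isCycle_finRotate.orderOf, support_finRotate, Finset.card_univ,
    Fintype.card_fin]

theorem relIndex_levelStab_one_Gamma_le (hm : 2 ≤ m) :
    (levelStab m 1).relIndex (Gamma m) ≤ m := by
  refine (relIndex_levelStab_le (α := Subgroup.zpowers (finRotate m))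
    (fun g => ⟨(g.2 []).choose, (g.2 []).choose_spec.1⟩) fun g h hgh v hv => ?_).trans
    (card_zpowers_finRotate hm).le
  obtain ⟨x, rfl⟩ := List.length_eq_one_iff.1 hv
  have h1 := (g.2 []).choose_spec.2 x
  have h2 := (h.2 []).choose_spec.2 x
  rw [List.nil_append, app_nil] at h1 h2
  have h3 : (g.2 []).choose = (h.2 []).choose := congrArg Subtype.val hgh
  rw [h1, h2, h3]

theorem relIndex_levelStab_Gamma_le (hm : 2 ≤ m) (n : ℕ) :
    (levelStab m n).relIndex (Gamma m) ≤ m ^ m ^ n := by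
  induction n with
  | zero =>
    have h := relIndex_levelStab_le (n := 0) (H := Gamma m) (α := Unit) (fun _ => ())
      fun g h _ v hv => by rw [List.eq_nil_of_length_eq_zero hv, app_nil, app_nil]
    rw [Nat.card_unique] at h
    exact h.trans (Nat.one_le_pow _ _ (by omega))
  | succ n ih =>
    calc (levelStab m (n + 1)).relIndex (Gamma m)
        ≤ (levelStab m n).relIndex (Gamma m) * (levelStab m 1).relIndex (Gamma m) ^ m ^ n :=
          relIndex_levelStab_add_le fun g hg v _ => sec_mem_Gamma hg v
      _ ≤ m ^ m ^ n * m ^ m ^ n :=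
          Nat.mul_le_mul ih (Nat.pow_le_pow_left (relIndex_levelStab_one_Gamma_le hm) _)
      _ = m ^ (2 * m ^ n) := by rw [← pow_add, two_mul]
      _ ≤ m ^ m ^ (n + 1) := by
          refine Nat.pow_le_pow_right (by omega) ?_
          rw [pow_succ']
          exact Nat.mul_le_mul_right _ hm

theorem le_relIndex_levelStab_succ_Gamma (hm : 2 ≤ m) (n : ℕ) :
    m ^ m ^ n ≤ (levelStab m (n + 1)).relIndex (Gamma m) := by
  have h := le_relIndex_levelStab (n := n + 1) (H := Gamma m)
    (α := {v : List (Fin m) // v.length = n} → Subgroup.zpowers (finRotate m))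
    (fun f => ⟨ofPortrait fun v => if hv : v.length = n then f ⟨v, hv⟩ else 1, fun v =>
      ⟨_, by
        split_ifs with hv
        · exact (f _).2
        · exact one_mem _, hasLabel_ofPortrait _ v⟩⟩)
    (fun a b hab => by
      ext v x
      have h1 := hab (v.1 ++ [x]) (by simp [v.2])
      dsimp only at h1
      rw [hasLabel_ofPortrait, hasLabel_ofPortrait] at h1
      have h2 := List.append_inj_right' h1 rfl
      rw [dif_pos v.2, dif_pos v.2] at h2
      exact congrArg Fin.val (List.cons.inj h2).1)
  rwa [Nat.card_fun, card_level, card_zpowers_finRotate hm] at h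

theorem relIndex_levelStab_topologicalClosure (G : Subgroup (TreeAut m)) (n : ℕ) :
    (levelStab m n).relIndex G.topologicalClosure ≤ (levelStab m n).relIndex G := by
  -- every element of the closure agrees on level `n` with an element of `G`
  have key : ∀ h : G.topologicalClosure, ∃ g : G, (g : TreeAut m)⁻¹ * h.1 ∈ levelStab m n := by
    intro h
    have hU : IsOpen ((fun x => x⁻¹ * h.1) ⁻¹' (levelStab m n : Set (TreeAut m))) :=
      (isOpen_levelStab n).preimage (continuous_inv.mul continuous_const)
    obtain ⟨g, hg, hgG⟩ := mem_closure_iff.1 h.2 _ hU (by simp [one_mem])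
    exact ⟨⟨g, hgG⟩, hg⟩
  choose f hf using key
  refine relIndex_levelStab_le
    (fun h => (QuotientGroup.mk (f h) : G ⧸ (levelStab m n).subgroupOf G))
    fun g h hgh v hv => ?_
  rw [← agree_of_inv_mul_mem (hf g) hv, ← agree_of_inv_mul_mem (hf h) hv]
  exact agree_of_mk_eq hgh hv

end TreeAut

/-! ### Zero Hausdorff dimension -/

namespace TreeAut

variable {m : ℕ}

theorem log_relIndex_Gamma_pos (hm : 2 ≤ m) {n : ℕ} (hn : 0 < n) :
    0 < Real.log ((levelStab m n).relIndex (Gamma m)) := by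
  refine Real.log_pos ?_
  have := relIndex_levelStab_ge hm n
  exact_mod_cast (by omega : 1 < (levelStab m n).relIndex (Gamma m))

theorem hdim_eq_zero {H : Subgroup (TreeAut m)} {N : ℕ → ℕ} (hN : Tendsto N atTop atTop)
    (hlim : Tendsto (fun j => Real.log ((levelStab m (N j)).relIndex H) /
      Real.log ((levelStab m (N j)).relIndex (Gamma m))) atTop (𝓝 0)) : hdim H = 0 := by
  have h0 : ∀ n : ℕ, 0 ≤ Real.log ((levelStab m n).relIndex H) /
      Real.log ((levelStab m n).relIndex (Gamma m)) := fun n =>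
    div_nonneg (Real.log_natCast_nonneg _) (Real.log_natCast_nonneg _)
  have hb : IsBoundedUnder (· ≥ ·) atTop (fun n : ℕ => Real.log ((levelStab m n).relIndex H) /
      Real.log ((levelStab m n).relIndex (Gamma m))) := isBoundedUnder_of ⟨0, h0⟩
  have hfr : ∀ ε > 0, ∃ᶠ n in atTop, Real.log ((levelStab m n).relIndex H) /
      Real.log ((levelStab m n).relIndex (Gamma m)) ≤ ε := fun ε hε =>
    hN.frequently (hlim.eventually_le_const hε).frequently
  refine le_antisymm (le_of_forall_pos_le_add fun ε hε => ?_) ?_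
  · rw [zero_add]
    exact liminf_le_of_frequently_le (hfr ε hε) hb
  · exact le_liminf_of_le (IsCoboundedUnder.of_frequently_le (hfr 1 one_pos))
      (Eventually.of_forall h0)

end TreeAut

/-- A set covered, for each `j`, by finitely many sets of diameter at most `r j`, where `r` tends
to `0` and the number of these sets grows more slowly than every power of `1 / r j`, has Hausdorff
dimension zero. -/
theorem dimH_eq_zero_of_cover {X : Type*} [EMetricSpace X] {S : Set X} {ι : ℕ → Type*}
    [∀ j, Fintype (ι j)] (t : ∀ j, ι j → Set X) (r : ℕ → ℝ≥0∞) (hr : Tendsto r atTop (𝓝 0))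
    (hd : ∀ j x, Metric.ediam (t j x) ≤ r j) (hc : ∀ j, S ⊆ ⋃ x, t j x)
    (h : ∀ s : ℝ≥0, 0 < s → ∀ᶠ j in atTop, (Fintype.card (ι j) : ℝ≥0∞) * r j ^ (s : ℝ) ≤ 1) :
    dimH S = 0 := by
  borelize X
  rw [← nonpos_iff_eq_zero]
  refine ENNReal.le_of_forall_pos_le_add fun s hs _ => ?_
  rw [zero_add]
  refine dimH_le_of_hausdorffMeasure_ne_top (ne_top_of_le_ne_top ENNReal.one_ne_top ?_)
  refine (MeasureTheory.Measure.hausdorffMeasure_le_liminf_sum (s : ℝ) _ r hr t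
    (Eventually.of_forall hd) (Eventually.of_forall hc)).trans ?_
  refine liminf_le_of_le (by isBoundedDefault) fun b hb => ?_
  obtain ⟨j, h1, h2⟩ := ((h s hs).and hb).exists
  refine (h2.trans ?_).trans h1
  calc ∑ x, Metric.ediam (t j x) ^ (s : ℝ)
      ≤ ∑ _x : ι j, r j ^ (s : ℝ) :=
        Finset.sum_le_sum fun x _ => ENNReal.rpow_le_rpow (hd j x) s.2
    _ = (Fintype.card (ι j) : ℝ≥0∞) * r j ^ (s : ℝ) := by
        rw [Finset.sum_const, nsmul_eq_mul, Finset.card_univ]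

namespace TreeAut

variable {m : ℕ}

theorem metricHdim_eq_zero (hm : 2 ≤ m) {H : Subgroup (TreeAut m)} {N : ℕ → ℕ}
    (hN : Tendsto N atTop atTop)
    (hlim : Tendsto (fun j => Real.log ((levelStab m (N j)).relIndex H) /
      Real.log ((levelStab m (N j)).relIndex (Gamma m))) atTop (𝓝 0)) :
    metricHdim hm H = 0 := by
  have hfin : ∀ n, Finite (H ⧸ (levelStab m n).subgroupOf H) := fun n => inferInstance
  let _ : ∀ n, Fintype (H ⧸ (levelStab m n).subgroupOf H) := fun n => Fintype.ofFinite _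
  -- the cosets of `St(N j)` cover `H`
  refine @dimH_eq_zero_of_cover (Gamma m) (gammaMetric hm).toEMetricSpace _
    (fun j => H ⧸ (levelStab m (N j)).subgroupOf H) _
    (fun j x => {g | ∃ h : g.1 ∈ H, QuotientGroup.mk ⟨g.1, h⟩ = x})
    (fun j => ((levelStab m (N j)).relIndex (Gamma m) : ℝ≥0∞)⁻¹) ?_ (fun j x => ?_)
    (fun j g hg => Set.mem_iUnion.2 ⟨QuotientGroup.mk ⟨g.1, hg⟩, hg, rfl⟩) (fun s hs => ?_)
  · refine tendsto_of_tendsto_of_tendsto_of_le_of_le tendsto_const_nhds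
      (ENNReal.tendsto_inv_nat_nhds_zero.comp hN) (fun _ => zero_le) fun j => ?_
    refine ENNReal.inv_le_inv.2 ?_
    have := relIndex_levelStab_ge hm (N j)
    exact_mod_cast (by omega : N j ≤ (levelStab m (N j)).relIndex (Gamma m))
  · refine @Metric.ediam_le (Gamma m) _ (gammaMetric hm).toPseudoEMetricSpace _ ?_
    rintro g ⟨hg, hgx⟩ h ⟨hh, hhx⟩
    have hd : gammaDist g h ≤ ((levelStab m (N j)).relIndex (Gamma m) : ℝ)⁻¹ :=
      ciInf_le (bddBelow_gammaDist g h) ⟨N j, fun v hv => agree_of_mk_eq (hgx.trans hhx.symm) hv⟩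
    rw [@edist_dist _ (gammaMetric hm).toPseudoMetricSpace]
    refine (ENNReal.ofReal_le_ofReal hd).trans (le_of_eq ?_)
    rw [ENNReal.ofReal_inv_of_pos (Nat.cast_pos.2 (relIndex_levelStab_pos _ _)),
      ENNReal.ofReal_natCast]
  · filter_upwards [hlim.eventually_le_const (show (0 : ℝ) < s from hs),
      hN.eventually_gt_atTop 0] with j h1 h2
    have hΓ : (0 : ℝ) < (levelStab m (N j)).relIndex (Gamma m) :=
      Nat.cast_pos.2 (relIndex_levelStab_pos _ _)
    -- the ratio of logarithms being at most `s`, the index in `H` is at most the `s`-th power of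
    -- the index in `Γ`
    have hle : ((levelStab m (N j)).relIndex H : ℝ) ≤
        ((levelStab m (N j)).relIndex (Gamma m) : ℝ) ^ (s : ℝ) := by
      rw [div_le_iff₀ (log_relIndex_Gamma_pos hm h2)] at h1
      rw [← Real.log_le_log_iff (Nat.cast_pos.2 (relIndex_levelStab_pos _ _))
        (Real.rpow_pos_of_pos hΓ _), Real.log_rpow hΓ]
      exact h1
    have hcard : Fintype.card (H ⧸ (levelStab m (N j)).subgroupOf H) =
        (levelStab m (N j)).relIndex H := Nat.card_eq_fintype_card.symm
    rw [hcard, ENNReal.inv_rpow, ← div_eq_mul_inv]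
    refine ENNReal.div_le_of_le_mul ?_
    rw [one_mul, ← ENNReal.ofReal_natCast, ← ENNReal.ofReal_natCast,
      ENNReal.ofReal_rpow_of_pos hΓ]
    exact ENNReal.ofReal_le_ofReal hle

end TreeAut

/-! ### Odometers acting on blocks of letters -/

theorem commutator_closure_le {G : Type*} [Group G] {S : Set G} {N : Subgroup G}
    (hN : ∀ g ∈ Subgroup.closure S, ∀ x ∈ N, g * x * g⁻¹ ∈ N)
    (h : ∀ x ∈ S, ∀ y ∈ S, ⁅x, y⁆ ∈ N) :
    ⁅Subgroup.closure S, Subgroup.closure S⁆ ≤ N := by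
  have key : ∀ T : Set G, T ⊆ Subgroup.closure S → (∀ x ∈ S, ∀ y ∈ T, ⁅x, y⁆ ∈ N) →
      ∀ x ∈ Subgroup.closure S, ∀ y ∈ T, ⁅x, y⁆ ∈ N := by
    intro T hT h x hx y hy
    induction hx using Subgroup.closure_induction with
    | mem x hx => exact h x hx y hy
    | one => simp [N.one_mem]
    | mul a b ha hb iha ihb =>
      have : ⁅a * b, y⁆ = a * ⁅b, y⁆ * a⁻¹ * ⁅a, y⁆ := by
        simp only [commutatorElement_def]
        group
      rw [this]
      exact mul_mem (hN a ha _ ihb) iha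
    | inv a ha iha =>
      have : ⁅a⁻¹, y⁆ = a⁻¹ * ⁅a, y⁆⁻¹ * a⁻¹⁻¹ := by
        simp only [commutatorElement_def]
        group
      rw [this]
      exact hN _ (inv_mem ha) _ (inv_mem iha)
  have h1 := key S Subgroup.subset_closure h
  rw [Subgroup.commutator_le]
  refine key _ subset_rfl fun x hx y hy => ?_
  rw [← commutatorElement_inv]
  exact inv_mem (h1 y hy x hx)

namespace TreeAut

variable {m : ℕ}

theorem sec_ofPortrait (P : List (Fin m) → Equiv.Perm (Fin m)) (v : List (Fin m)) :
    sec (ofPortrait P) v = ofPortrait fun s => P (v ++ s) :=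
  sec_eq_of_forall (w := portraitFun P v) (length_portraitFun v P) fun u =>
    portraitFun_append v P u

theorem ofPortrait_mem_levelStab {P : List (Fin m) → Equiv.Perm (Fin m)} {n : ℕ}
    (h : ∀ v, v.length < n → P v = 1) : ofPortrait P ∈ levelStab m n :=
  fun v hv => portraitFun_eq_self v P fun u hu => h u (hv ▸ hu)

theorem ofPortrait_one : ofPortrait (fun _ : List (Fin m) => 1) = 1 :=
  ext_app fun v => portraitFun_eq_self v _ fun _ _ => rfl

theorem ofPortrait_mem_Gamma {P : List (Fin m) → Equiv.Perm (Fin m)}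
    (h : ∀ v, P v ∈ Subgroup.zpowers (finRotate m)) : ofPortrait P ∈ Gamma m :=
  fun v => ⟨P v, h v, hasLabel_ofPortrait P v⟩

/-- The labels of the odometer truncated at depth `r`: `σ` at the words of length less than `r`
all of whose letters are the last one. -/
def odoLabel (m r : ℕ) (v : List (Fin m)) : Equiv.Perm (Fin m) :=
  if v.length < r ∧ ∀ x ∈ v, x.val + 1 = m then finRotate m else 1

/-- The odometer (adding machine) truncated at depth `r`: it adds `1`, with carry to the right, to
the number modulo `m ^ r` whose digits, the least significant one first, are the first `r`
letters. -/
def odo (m r : ℕ) : TreeAut m := ofPortrait (odoLabel m r)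

/-- The labels of `blockOdo m r i`. -/
def blockLabel (m r i : ℕ) (v : List (Fin m)) : Equiv.Perm (Fin m) :=
  if r * i ≤ v.length then odoLabel m r (v.drop (r * i)) else 1

/-- The automorphism acting as the truncated odometer on the letters in the positions
`r * i, ..., r * i + r - 1`, that is, on the `i`-th block of `r` letters. -/
def blockOdo (m r i : ℕ) : TreeAut m := ofPortrait (blockLabel m r i)

theorem odoLabel_mem (r : ℕ) (v : List (Fin m)) :
    odoLabel m r v ∈ Subgroup.zpowers (finRotate m) := by
  rw [odoLabel]
  split_ifs
  · exact Subgroup.mem_zpowers _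
  · exact one_mem _

theorem blockLabel_mem (r i : ℕ) (v : List (Fin m)) :
    blockLabel m r i v ∈ Subgroup.zpowers (finRotate m) := by
  rw [blockLabel]
  split_ifs
  · exact odoLabel_mem _ _
  · exact one_mem _

theorem odoLabel_of_le {r : ℕ} {v : List (Fin m)} (h : r ≤ v.length) : odoLabel m r v = 1 :=
  if_neg fun H => by omega

theorem sec_odo {r : ℕ} {v : List (Fin m)} (h : r ≤ v.length) : sec (odo m r) v = 1 := by
  rw [odo, sec_ofPortrait, ← ofPortrait_one]
  congr
  funext s
  exact odoLabel_of_le (by simp; omega)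

theorem blockOdo_mem_levelStab (r i : ℕ) : blockOdo m r i ∈ levelStab m (r * i) :=
  ofPortrait_mem_levelStab fun _ hv => if_neg (by omega)

theorem sec_blockOdo_eq_odo {r i : ℕ} {v : List (Fin m)} (h : v.length = r * i) :
    sec (blockOdo m r i) v = odo m r := by
  rw [blockOdo, sec_ofPortrait, odo]
  congr
  funext s
  rw [blockLabel, if_pos (by simp [h]), ← h, List.drop_left]

theorem sec_blockOdo_eq_one {r i : ℕ} {v : List (Fin m)} (h : r * (i + 1) ≤ v.length) :
    sec (blockOdo m r i) v = 1 := by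
  have hl : r * (i + 1) = r * i + r := by ring
  rw [← List.take_append_drop (r * i) v, sec_append,
    sec_blockOdo_eq_odo (by simp only [List.length_take]; omega),
    sec_odo (by simp only [List.length_drop]; omega)]

/-- The number whose base `m` digits, the least significant one first, are the letters of `v`. -/
def digitValue (v : List (Fin m)) : ℕ := Nat.ofDigits m (v.map Fin.val)

theorem digitValue_cons (x : Fin m) (v : List (Fin m)) :
    digitValue (x :: v) = x + m * digitValue v := by
  rw [digitValue, List.map_cons, Nat.ofDigits_cons]
  rfl

theorem digitValue_lt (hm : 2 ≤ m) (v : List (Fin m)) : digitValue v < m ^ v.length := by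
  have := Nat.ofDigits_lt_base_pow_length (b := m) (l := v.map Fin.val) (by omega) (by simp)
  rwa [List.length_map] at this

theorem eq_of_digitValue_modEq (hm : 2 ≤ m) {r : ℕ} {v w : List (Fin m)} (hv : v.length = r)
    (hw : w.length = r) (h : digitValue v ≡ digitValue w [MOD m ^ r]) : v = w := by
  have h1 := Nat.ModEq.eq_of_lt_of_lt h (hv ▸ digitValue_lt hm v) (hw ▸ digitValue_lt hm w)
  have h2 := Nat.ofDigits_inj_of_len_eq (b := m) (by omega) (by simp [hv, hw]) (by simp)
    (by simp) h1
  exact List.map_injective_iff.2 Fin.val_injective h2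

theorem val_finRotate_of_ne {x : Fin m} (h : x.val + 1 ≠ m) :
    (finRotate m x).val = x.val + 1 := by
  obtain ⟨d, rfl⟩ := Nat.exists_eq_add_of_le' x.pos
  exact coe_finRotate_of_ne_last fun H => h (by simp [H])

theorem val_finRotate_of_eq {x : Fin m} (h : x.val + 1 = m) : (finRotate m x).val = 0 := by
  obtain ⟨d, rfl⟩ := Nat.exists_eq_add_of_le' x.pos
  have : x = Fin.last _ := Fin.ext (by simp; omega)
  rw [this, finRotate_last]
  rfl

theorem digitValue_odo (r : ℕ) : ∀ v : List (Fin m), v.length = r →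
    digitValue (app (odo m r) v) ≡ digitValue v + 1 [MOD m ^ r] := by
  induction r with
  | zero => exact fun v _ => by simpa using Nat.modEq_one
  | succ r ih =>
    intro v hv
    obtain ⟨x, w, rfl⟩ := List.exists_cons_of_length_eq_add_one hv
    have hw : w.length = r := by simpa using hv
    have h0 : app (odo m (r + 1)) (x :: w) =
        finRotate m x :: portraitFun (fun u => odoLabel m (r + 1) (x :: u)) w := by
      change portraitFun _ _ = _
      rw [portraitFun]
      simp [odoLabel]
    rw [h0, digitValue_cons, digitValue_cons]
    by_cases hx : x.val + 1 = m
    · have h1 : (fun u => odoLabel m (r + 1) (x :: u)) = odoLabel m r := by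
        funext u
        simp [odoLabel, hx]
      have h2 := (ih w hw).mul_left' m
      rw [← pow_succ'] at h2
      rw [h1, val_finRotate_of_eq hx, zero_add]
      refine h2.trans (Nat.ModEq.symm ?_)
      rw [show x.val + m * digitValue w + 1 = m * (digitValue w + 1) by rw [mul_add]; omega]
    · rw [val_finRotate_of_ne hx, portraitFun_eq_self w _ fun u _ => by simp [odoLabel, hx]]
      rw [add_right_comm]

theorem digitValue_odo_pow {r : ℕ} (c : ℕ) {v : List (Fin m)} (hv : v.length = r) :
    digitValue (app (odo m r ^ c) v) ≡ digitValue v + c [MOD m ^ r] := by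
  induction c with
  | zero => exact Nat.ModEq.refl _
  | succ c ih =>
    rw [pow_succ', app_mul, ← add_assoc]
    exact (digitValue_odo r _ (by rw [length_app, hv])).trans (ih.add_right 1)

theorem sec_pow_eq_one {g : TreeAut m} {N : ℕ} (h : ∀ v : List (Fin m), N ≤ v.length → sec g v = 1)
    (c : ℕ) {v : List (Fin m)} (hv : N ≤ v.length) : sec (g ^ c) v = 1 := by
  induction c with
  | zero => simp
  | succ c ih => rw [pow_succ', sec_mul, ih, h _ (by rwa [length_app]), mul_one]

theorem odo_pow_eq_one (hm : 2 ≤ m) (r : ℕ) : odo m r ^ m ^ r = 1 := by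
  refine ext_of_long (by omega) r fun v w hv => ?_
  rw [app_append, sec_pow_eq_one (fun u hu => sec_odo hu) _ hv.ge, app_one, app_one]
  congr 1
  refine eq_of_digitValue_modEq hm (by rw [length_app, hv]) hv ((digitValue_odo_pow _ hv).trans ?_)
  exact Nat.add_modEq_right

theorem exists_odo_pow (hm : 2 ≤ m) {r : ℕ} {v w : List (Fin m)} (hv : v.length = r)
    (hw : w.length = r) : ∃ c, app (odo m r ^ c) v = w := by
  refine ⟨digitValue w + (m ^ r - digitValue v), eq_of_digitValue_modEq hm
    (by rw [length_app, hv]) hw ((digitValue_odo_pow _ hv).trans ?_)⟩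
  have := hv ▸ digitValue_lt hm v
  rw [show digitValue v + (digitValue w + (m ^ r - digitValue v)) = digitValue w + m ^ r by omega]
  exact Nat.add_modEq_right

theorem sec_pow_of_mem {N : ℕ} {g : TreeAut m} (hg : g ∈ levelStab m N) {v : List (Fin m)}
    (hv : v.length = N) (c : ℕ) : sec (g ^ c) v = sec g v ^ c := by
  induction c with
  | zero => simp
  | succ c ih => rw [pow_succ, sec_mul_of_mem _ hg hv, ih, pow_succ]

theorem blockOdo_pow_eq_one (hm : 2 ≤ m) (r i : ℕ) : blockOdo m r i ^ m ^ r = 1 :=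
  levelStab_ext (by omega) (pow_mem (blockOdo_mem_levelStab r i) _) (one_mem _) fun v hv => by
    rw [sec_pow_of_mem (blockOdo_mem_levelStab r i) hv, sec_blockOdo_eq_odo hv, odo_pow_eq_one hm,
      sec_one]

theorem blockOdo_commute (hm : 2 ≤ m) (r i j : ℕ) :
    blockOdo m r i * blockOdo m r j = blockOdo m r j * blockOdo m r i := by
  wlog hij : i < j generalizing i j
  · obtain rfl | h := eq_or_lt_of_le (not_lt.1 hij)
    · rfl
    · exact (this j i h).symm
  refine ext_of_long (by omega) (r * j) fun v w hv => ?_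
  have hi : r * (i + 1) ≤ r * j := Nat.mul_le_mul_left r hij
  have hv' : (app (blockOdo m r i) v).length = r * j := by rw [length_app, hv]
  have h1 : app (blockOdo m r i) (v ++ w) = app (blockOdo m r i) v ++ w := by
    rw [app_append, sec_blockOdo_eq_one (by omega), app_one]
  have h2 : app (blockOdo m r j) (v ++ w) = v ++ app (odo m r) w := by
    rw [app_append, blockOdo_mem_levelStab r j v hv, sec_blockOdo_eq_odo hv]
  rw [app_mul, app_mul, h1, h2, app_append, app_append, sec_blockOdo_eq_one (by omega),
    blockOdo_mem_levelStab r j _ hv', sec_blockOdo_eq_odo hv', app_one]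

/-- The value modulo `m ^ r` of the first block of `r` letters. -/
def firstBlock (r : ℕ) (v : List (Fin m)) : ZMod (m ^ r) := (digitValue (v.take r) : ℕ)

theorem firstBlock_odo {r : ℕ} {v : List (Fin m)} (hv : r ≤ v.length) :
    firstBlock r (app (odo m r) v) = firstBlock r v + 1 := by
  have hl : (v.take r).length = r := by simp [hv]
  have h1 : (app (odo m r) v).take r = app (odo m r) (v.take r) := by
    conv_lhs => rw [← List.take_append_drop r v, app_append]
    rw [List.take_left' (by rw [length_app, hl])]
  have h2 := (ZMod.natCast_eq_natCast_iff _ _ _).2 (digitValue_odo r _ hl)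
  rw [firstBlock, firstBlock, h1, h2]
  push_cast
  rfl

theorem blockOdo_zero (r : ℕ) : blockOdo m r 0 = odo m r := by
  rw [← sec_blockOdo_eq_odo (i := 0) (v := []) (by simp), sec_nil]

theorem firstBlock_blockOdo {r i : ℕ} (hi : i ≠ 0) {v : List (Fin m)} (hv : r ≤ v.length) :
    firstBlock r (app (blockOdo m r i) v) = firstBlock r v := by
  have hm : 0 < m ∨ v = [] := by
    cases v with
    | nil => exact Or.inr rfl
    | cons x _ => exact Or.inl x.pos
  rcases hm with hm | rfl
  · have hl : (v.take r).length = r := by simp [hv]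
    have h1 : r ≤ r * i := Nat.le_mul_of_pos_right r (Nat.pos_of_ne_zero hi)
    rw [firstBlock, ← List.take_append_drop r v, app_append,
      levelStab_anti h1 hm (blockOdo_mem_levelStab r i) _ hl, List.take_left' hl, firstBlock,
      List.take_left' hl]
  · rw [app_nil]

/-- The group generated by the odometers acting on the first `k` blocks of `r` letters. It is
abelian of exponent `m ^ r` and acts regularly on level `r * k`. -/
def blockGroup (m r k : ℕ) : Subgroup (TreeAut m) :=
  Subgroup.closure {g | ∃ i < k, g = blockOdo m r i}

theorem blockOdo_mem_blockGroup {r k i : ℕ} (h : i < k) : blockOdo m r i ∈ blockGroup m r k :=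
  Subgroup.subset_closure ⟨i, h, rfl⟩

theorem blockGroup_mono (r : ℕ) {k k' : ℕ} (h : k ≤ k') : blockGroup m r k ≤ blockGroup m r k' :=
  Subgroup.closure_mono fun _ ⟨i, hi, hg⟩ => ⟨i, hi.trans_le h, hg⟩

theorem blockGroup_commute (hm : 2 ≤ m) {r k : ℕ} {a b : TreeAut m} (ha : a ∈ blockGroup m r k)
    (hb : b ∈ blockGroup m r k) : a * b = b * a := by
  have h : ⁅blockGroup m r k, blockGroup m r k⁆ ≤ ⊥ := by
    refine commutator_closure_le (N := (⊥ : Subgroup (TreeAut m))) (fun g _ x hx => ?_) ?_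
    · rw [Subgroup.mem_bot] at hx ⊢
      rw [hx, mul_one, mul_inv_cancel]
    · rintro _ ⟨i, _, rfl⟩ _ ⟨j, _, rfl⟩
      rw [Subgroup.mem_bot, commutatorElement_eq_one_iff_mul_comm]
      exact blockOdo_commute hm r i j
  exact commutatorElement_eq_one_iff_mul_comm.1
    (Subgroup.mem_bot.1 (h (Subgroup.commutator_mem_commutator ha hb)))

theorem blockGroup_pow_eq_one (hm : 2 ≤ m) {r k : ℕ} {a : TreeAut m}
    (ha : a ∈ blockGroup m r k) : a ^ m ^ r = 1 := by
  induction ha using Subgroup.closure_induction with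
  | mem a ha =>
    obtain ⟨i, _, rfl⟩ := ha
    exact blockOdo_pow_eq_one hm r i
  | one => exact one_pow _
  | mul a b ha hb iha ihb =>
    rw [Commute.mul_pow (blockGroup_commute hm ha hb), iha, ihb, one_mul]
  | inv a _ iha => rw [inv_pow, iha, inv_one]

theorem sec_blockGroup {r k : ℕ} {a : TreeAut m} (ha : a ∈ blockGroup m r k) :
    ∀ {v : List (Fin m)}, r * k ≤ v.length → sec a v = 1 := by
  induction ha using Subgroup.closure_induction with
  | mem a ha =>
    obtain ⟨i, hi, rfl⟩ := ha
    intro v hv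
    exact sec_blockOdo_eq_one ((Nat.mul_le_mul_left r hi).trans hv)
  | one => exact fun _ => sec_one _
  | mul a b _ _ iha ihb =>
    intro v hv
    rw [sec_mul, ihb hv, iha (by rwa [length_app]), mul_one]
  | inv a _ iha =>
    intro v hv
    rw [sec_inv, iha (by rwa [length_app]), inv_one]

theorem blockGroup_le_Gamma (r k : ℕ) : blockGroup m r k ≤ Gamma m := by
  refine (Subgroup.closure_le _).2 ?_
  rintro _ ⟨i, _, rfl⟩
  exact ofPortrait_mem_Gamma fun v => blockLabel_mem r i v

theorem exists_firstBlock_blockGroup {r k : ℕ} {a : TreeAut m} (ha : a ∈ blockGroup m r k) :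
    ∃ c, ∀ v : List (Fin m), r ≤ v.length → firstBlock r (app a v) = firstBlock r v + c := by
  induction ha using Subgroup.closure_induction with
  | mem a ha =>
    obtain ⟨i, _, rfl⟩ := ha
    rcases Nat.eq_zero_or_pos i with rfl | hi
    · exact ⟨1, fun v hv => by rw [blockOdo_zero, firstBlock_odo hv]⟩
    · exact ⟨0, fun v hv => by rw [firstBlock_blockOdo hi.ne' hv, add_zero]⟩
  | one => exact ⟨0, fun v _ => by rw [app_one, add_zero]⟩
  | mul a b _ _ iha ihb =>
    obtain ⟨c, hc⟩ := iha
    obtain ⟨d, hd⟩ := ihb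
    exact ⟨d + c, fun v hv => by rw [app_mul, hc _ (by rwa [length_app]), hd v hv, add_assoc]⟩
  | inv a _ iha =>
    obtain ⟨c, hc⟩ := iha
    refine ⟨-c, fun v hv => ?_⟩
    have := hc (app a⁻¹ v) (by rwa [length_app])
    rw [app_app_inv] at this
    rw [this, add_neg_cancel_right]

theorem firstBlock_odo_pow {r : ℕ} (c : ℕ) {v : List (Fin m)} (hv : r ≤ v.length) :
    firstBlock r (app (odo m r ^ c) v) = firstBlock r v + c := by
  induction c with
  | zero => simp [app_one]
  | succ c ih =>
    rw [pow_succ', app_mul, firstBlock_odo (by rwa [length_app]), ih]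
    push_cast
    ring

theorem exists_blockGroup_app_eq (hm : 2 ≤ m) {r k : ℕ} :
    ∀ {u v : List (Fin m)}, u.length = r * k → v.length = r * k →
      ∃ a ∈ blockGroup m r k, app a u = v := by
  induction k with
  | zero =>
    intro u v hu hv
    exact ⟨1, one_mem _, by
      rw [List.eq_nil_of_length_eq_zero hu, List.eq_nil_of_length_eq_zero hv, app_nil]⟩
  | succ k ih =>
    intro u v hu hv
    have hl : r * (k + 1) = r * k + r := by ring
    have hu1 : (u.take (r * k)).length = r * k := by simp only [List.length_take]; omega
    have hv1 : (v.take (r * k)).length = r * k := by simp only [List.length_take]; omega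
    have hu2 : (u.drop (r * k)).length = r := by simp only [List.length_drop]; omega
    have hv2 : (v.drop (r * k)).length = r := by simp only [List.length_drop]; omega
    obtain ⟨a, ha, hau⟩ := ih hu1 hv1
    obtain ⟨c, hc⟩ := exists_odo_pow hm hu2 hv2
    refine ⟨blockOdo m r k ^ c * a, mul_mem (pow_mem (blockOdo_mem_blockGroup k.lt_succ_self) c)
      (blockGroup_mono r k.le_succ ha), ?_⟩
    conv_lhs => rw [← List.take_append_drop (r * k) u]
    rw [app_mul, app_append, hau, sec_blockGroup ha hu1.ge, app_one, app_append,
      pow_mem (blockOdo_mem_levelStab r k) c _ hv1,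
      sec_pow_of_mem (blockOdo_mem_levelStab r k) hv1, sec_blockOdo_eq_odo hv1, hc,
      List.take_append_drop]

end TreeAut

/-! ### Groups generated by block odometers and a directed automorphism -/

namespace TreeAut

variable {m : ℕ}

/-- A sequence of directed automorphisms of the `m`-adic tree. The automorphism `dir n` fixes the
level `r * blocks n`, its section at a distinguished vertex `last n` of this level is
`dir (n + 1)`, and its other sections are elements of `blockGroup m r (blocks (n + 1))`, trivial
at the vertices whose first block is not zero, among which are all generators of that group. -/
structure DirectedSystem (m r : ℕ) where
  /-- The number of blocks of `r` letters in the words of the level fixed by `dir n`. -/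
  blocks : ℕ → ℕ
  /-- The directed automorphisms. -/
  dir : ℕ → TreeAut m
  /-- The sections of `dir n` at the vertices of level `r * blocks n`. -/
  part : ℕ → List (Fin m) → TreeAut m
  /-- The vertex at which the section of `dir n` is `dir (n + 1)`. -/
  last : ℕ → List (Fin m)
  two_le : 2 ≤ m
  five_le : 5 ≤ m ^ r
  blocks_pos : ∀ n, 0 < blocks n
  tendsto_blocks : Tendsto blocks atTop atTop
  app_dir_append : ∀ n v u, v.length = r * blocks n →
    app (dir n) (v ++ u) = v ++ app (part n v) u
  length_last : ∀ n, (last n).length = r * blocks n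
  firstBlock_last : ∀ n, firstBlock r (last n) = -1
  part_last : ∀ n, part n (last n) = dir (n + 1)
  part_mem : ∀ n v, v.length = r * blocks n → v ≠ last n →
    part n v ∈ blockGroup m r (blocks (n + 1))
  part_eq_one : ∀ n v, v.length = r * blocks n → v ≠ last n → firstBlock r v ≠ 0 → part n v = 1
  exists_part_eq : ∀ n, ∀ i < blocks (n + 1), ∃ v, v.length = r * blocks n ∧
    firstBlock r v = 0 ∧ part n v = blockOdo m r i

/-- An element normalizing a subgroup normalizes its derived subgroup. -/
theorem conj_mem_commutator {G : Type*} [Group G] {H : Subgroup G} {g : G}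
    (hg : ∀ x ∈ H, g * x * g⁻¹ ∈ H) {x : G} (hx : x ∈ ⁅H, H⁆) : g * x * g⁻¹ ∈ ⁅H, H⁆ := by
  have h1 : H.map (MulAut.conj g).toMonoidHom ≤ H := by
    rintro _ ⟨y, hy, rfl⟩
    exact hg y hy
  have h2 := Subgroup.mem_map_of_mem (MulAut.conj g).toMonoidHom hx
  rw [Subgroup.map_commutator] at h2
  exact Subgroup.commutator_mono h1 h1 h2

/-- A finitely generated group with generators of finite order has a finite abelianization. -/
theorem finite_abelianization_of_closure {G : Type*} [Group G] {S : Set G} (hS : S.Finite) {e : ℕ}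
    (he : 0 < e) (h : ∀ x ∈ S, x ^ e = 1) :
    ⁅Subgroup.closure S, Subgroup.closure S⁆.relIndex (Subgroup.closure S) ≠ 0 := by
  set H := Subgroup.closure S with hH
  have hfg : Group.FG H := (Group.fg_iff_subgroup_fg H).2 ⟨hS.toFinset, by simp [hH]⟩
  have hfg' : Group.FG (Abelianization H) := QuotientGroup.fg (commutator H)
  have hpow : ∀ x (hx : x ∈ H), Abelianization.of (⟨x, hx⟩ : H) ^ e = 1 := by
    intro x hx
    induction hx using Subgroup.closure_induction with
    | mem x hx =>
      have hx1 : (⟨x, Subgroup.subset_closure hx⟩ : H) ^ e = 1 := Subtype.ext (h x hx)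
      rw [← map_pow, hx1, map_one]
    | one => exact (congrArg (· ^ e) (map_one Abelianization.of)).trans (one_pow e)
    | mul x y hx hy ihx ihy =>
      have : (⟨x * y, mul_mem hx hy⟩ : H) = ⟨x, hx⟩ * ⟨y, hy⟩ := rfl
      rw [this, map_mul, mul_pow, ihx, ihy, one_mul]
    | inv x hx ihx =>
      have : (⟨x⁻¹, inv_mem hx⟩ : H) = ⟨x, hx⟩⁻¹ := rfl
      rw [this, map_inv, inv_pow, ihx, inv_one]
  have hfin : Finite (H ⧸ commutator H) := by
    refine CommGroup.finite_of_fg_isMulTorsion (Abelianization H) fun x => ?_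
    obtain ⟨y, rfl⟩ := QuotientGroup.mk_surjective x
    exact isOfFinOrder_iff_pow_eq_one.2 ⟨e, he, hpow y.1 y.2⟩
  have h1 : ⁅H, H⁆.subgroupOf H = commutator H := by
    rw [← Subgroup.map_subtype_commutator]
    exact Subgroup.comap_map_eq_self_of_injective H.subtype_injective _
  rw [Subgroup.relIndex, h1]
  exact (Subgroup.finiteIndex_of_finite_quotient (H := commutator H)).index_ne_zero

/-- A group transitive on every level has unbounded orbits. -/
theorem infinite_of_levelTransitive (hm : 2 ≤ m) {G : Subgroup (TreeAut m)}
    (hG : LevelTransitive G) : Infinite G := by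
  rw [← not_finite_iff_infinite]
  intro hfin
  let L := Nat.card G
  have hl : (List.replicate L (⟨0, by omega⟩ : Fin m)).length = L := List.length_replicate
  have h := Nat.card_le_card_of_surjective (β := {v : List (Fin m) // v.length = L})
    (fun g : G => ⟨app g.1 (List.replicate L ⟨0, by omega⟩), by rw [length_app, hl]⟩) fun v => by
      obtain ⟨g, hg, hgv⟩ := hG (List.replicate L ⟨0, by omega⟩) v.1 (hl.trans v.2.symm)
      exact ⟨⟨g, hg⟩, Subtype.ext hgv⟩
  rw [card_level] at h
  exact absurd h (not_le.2 (Nat.lt_pow_self (by omega)))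

theorem relIndex_levelProd_ne_zero {N : ℕ} {F G K : Subgroup (TreeAut m)} (hF : F.relIndex K ≠ 0)
    (h : ∀ g ∈ G, ∀ v : List (Fin m), v.length = N → sec g v ∈ K) :
    (levelProd N fun _ => F).relIndex G ≠ 0 := by
  have hF' : (F.subgroupOf K).FiniteIndex := ⟨hF⟩
  let f : G → (G ⧸ (levelStab m N).subgroupOf G) ×
      ({v : List (Fin m) // v.length = N} → K ⧸ F.subgroupOf K) :=
    fun g => (QuotientGroup.mk g, fun v => QuotientGroup.mk ⟨sec g.1 v.1, h g.1 g.2 v.1 v.2⟩)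
  have hfin : Finite (G ⧸ (levelProd N fun _ => F).subgroupOf G) := by
    refine Finite.of_injective (fun x => f x.out) fun x y hxy => ?_
    rw [← QuotientGroup.out_eq' x, ← QuotientGroup.out_eq' y, QuotientGroup.eq]
    obtain ⟨h1, h2⟩ := Prod.mk.injEq .. ▸ hxy
    have h3 : (x.out)⁻¹ * y.out ∈ (levelStab m N).subgroupOf G := QuotientGroup.eq.1 h1
    refine ⟨h3, fun v hv => ?_⟩
    have h4 : (⟨sec x.out.1 v, h _ x.out.2 v hv⟩ : K)⁻¹ * ⟨sec y.out.1 v, h _ y.out.2 v hv⟩ ∈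
      F.subgroupOf K := QuotientGroup.eq.1 (congrFun h2 ⟨v, hv⟩)
    have h5 : sec (x.out.1⁻¹ * y.out.1) v = (sec x.out.1 v)⁻¹ * sec y.out.1 v := by
      rw [sec_mul, sec_inv, ← agree_of_mk_eq h1 hv, app_inv_app]
    exact h5 ▸ h4
  exact (Subgroup.finiteIndex_of_finite_quotient
    (H := (levelProd N fun _ => F).subgroupOf G)).index_ne_zero

/-- Automorphisms supported on the subtrees hanging from different vertices of a level commute. -/
theorem lift_mul_lift_of_ne {u v : List (Fin m)} (hl : u.length = v.length) (h : u ≠ v)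
    (a b : TreeAut m) : lift u a * lift v b = lift v b * lift u a := by
  rw [← mul_inv_eq_iff_eq_mul, conj_lift, sec_lift_of_ne a hl.symm h.symm,
    lift_mem_levelStab u a v hl.symm, one_mul, inv_one, mul_one]

/-- If `g ∈ N` moves the vertex `v`, then `N` contains the derived subgroup of every group acting
on the subtree hanging from `v` whose elements normalize `N`. -/
theorem commutator_le_comap_lift {N K : Subgroup (TreeAut m)} {g : TreeAut m} (hg : g ∈ N)
    {v : List (Fin m)} (hgv : app g v ≠ v)
    (hN : ∀ a ∈ K, ∀ x ∈ N, lift v a * x * (lift v a)⁻¹ ∈ N) :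
    ⁅K, K⁆ ≤ N.comap (lift v) := by
  rw [Subgroup.commutator_le]
  intro x hx y hy
  rw [Subgroup.mem_comap, map_commutatorElement]
  set X := lift v x with hX
  set Y := lift v y with hY
  have hc : g * (X⁻¹ * g⁻¹ * X) ∈ N := by
    have h1 := hN x⁻¹ (inv_mem hx) g⁻¹ (inv_mem hg)
    rw [map_inv, inv_inv] at h1
    exact mul_mem hg h1
  -- `Z` is supported on the subtree hanging from `g v`
  set Z := g * X⁻¹ * g⁻¹ with hZ
  have hZY : Z * Y = Y * Z := by
    rw [hZ, hX, ← map_inv, conj_lift, hY]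
    exact lift_mul_lift_of_ne (length_app g v) hgv _ _
  have hZX : Z * X = X * Z := by
    rw [hZ, hX, ← map_inv, conj_lift]
    exact lift_mul_lift_of_ne (length_app g v) hgv _ _
  have h2 := mul_mem hc (hN y hy _ (inv_mem hc))
  have h3 : g * (X⁻¹ * g⁻¹ * X) = Z * X := by
    rw [hZ]
    group
  rw [h3, ← hY] at h2
  have h4 : Z * X * (Y * (Z * X)⁻¹ * Y⁻¹) = ⁅X, Y⁆ := by
    rw [hZX, commutatorElement_def, mul_inv_rev]
    calc X * Z * (Y * (Z⁻¹ * X⁻¹) * Y⁻¹) = X * (Z * Y) * Z⁻¹ * X⁻¹ * Y⁻¹ := by group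
      _ = X * Y * X⁻¹ * Y⁻¹ := by rw [hZY]; group
  rwa [h4] at h2

namespace DirectedSystem

variable {r : ℕ} (S : DirectedSystem m r)

/-- The level fixed by `S.dir n`. -/
def level (n : ℕ) : ℕ := r * S.blocks n

/-- The generators of `S.group n`. -/
def gens (n : ℕ) : Set (TreeAut m) := {g | ∃ i < S.blocks n, g = blockOdo m r i} ∪ {S.dir n}

/-- The group generated by the odometers acting on the first `S.blocks n` blocks of letters and by
the directed automorphism `S.dir n`. -/
def group (n : ℕ) : Subgroup (TreeAut m) := Subgroup.closure (S.gens n)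

/-- The derived subgroup of `S.group n`. -/
def derived (n : ℕ) : Subgroup (TreeAut m) := ⁅S.group n, S.group n⁆

/-- The level `S.level n + ... + S.level (n + j - 1)`, at which the sections of the elements of
`S.group n` are elements of `S.group (n + j)`. -/
def depth (n : ℕ) : ℕ → ℕ
  | 0 => 0
  | j + 1 => depth n j + S.level (n + j)

include S in
theorem pos : 0 < m := by
  have := S.two_le
  omega

include S in
theorem r_pos : 0 < r := by
  rcases Nat.eq_zero_or_pos r with rfl | h
  · exact absurd S.five_le (by simp)
  · exact h

theorem level_pos (n : ℕ) : 0 < S.level n := Nat.mul_pos S.r_pos (S.blocks_pos n)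

theorem le_level (n : ℕ) : r ≤ S.level n := Nat.le_mul_of_pos_right r (S.blocks_pos n)

theorem le_depth (n j : ℕ) : j ≤ S.depth n j := by
  induction j with
  | zero => exact le_rfl
  | succ j ih => exact add_le_add ih (S.level_pos (n + j))

theorem dir_mem_levelStab (n : ℕ) : S.dir n ∈ levelStab m (S.level n) := fun v hv => by
  have := S.app_dir_append n v [] hv
  rwa [app_nil, List.append_nil] at this

theorem sec_dir {n : ℕ} {v : List (Fin m)} (hv : v.length = S.level n) :
    sec (S.dir n) v = S.part n v :=
  sec_eq_of_forall (w := v) rfl fun u => S.app_dir_append n v u hv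

theorem dir_mem_Gamma (n : ℕ) : S.dir n ∈ Gamma m := by
  suffices h : ∀ (L n : ℕ) (v : List (Fin m)), v.length = L →
      ∃ τ ∈ Subgroup.zpowers (finRotate m), HasLabel (S.dir n) v τ from fun v => h _ n v rfl
  intro L
  induction L using Nat.strong_induction_on with
  | _ L ih =>
    intro n v hv
    by_cases hL : L < S.level n
    · have hfix : ∀ w : List (Fin m), w.length ≤ S.level n → app (S.dir n) w = w := fun w hw =>
        levelStab_anti hw S.pos (S.dir_mem_levelStab n) w rfl
      refine ⟨1, one_mem _, fun x => ?_⟩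
      rw [hfix v (by omega), hfix _ (by simp; omega)]
      rfl
    · have h1 : (v.take (S.level n)).length = S.level n := by
        simp only [List.length_take]
        omega
      have h2 : ∃ τ ∈ Subgroup.zpowers (finRotate m),
          HasLabel (S.part n (v.take (S.level n))) (v.drop (S.level n)) τ := by
        by_cases ht : v.take (S.level n) = S.last n
        · rw [ht, S.part_last]
          have := S.level_pos n
          exact ih (L - S.level n) (by omega) _ _ (by simp [hv])
        · exact blockGroup_le_Gamma _ _ (S.part_mem n _ h1 ht) _
      obtain ⟨τ, hτ, h3⟩ := h2
      refine ⟨τ, hτ, fun x => ?_⟩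
      rw [← List.take_append_drop (S.level n) v, List.append_assoc, S.app_dir_append n _ _ h1,
        S.app_dir_append n _ _ h1, h3, List.append_assoc]

theorem dir_pow_eq_one (n : ℕ) : S.dir n ^ m ^ r = 1 := by
  suffices h : ∀ (L n : ℕ) (v : List (Fin m)), v.length = L → app (S.dir n ^ m ^ r) v = v from
    ext_app fun v => h _ n v rfl
  intro L
  induction L using Nat.strong_induction_on with
  | _ L ih =>
    intro n v hv
    by_cases hL : L < S.level n
    · exact levelStab_anti (hv.trans_le hL.le) S.pos (pow_mem (S.dir_mem_levelStab n) _) v rfl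
    · have h1 : (v.take (S.level n)).length = S.level n := by
        simp only [List.length_take]
        omega
      rw [← List.take_append_drop (S.level n) v, app_append,
        pow_mem (S.dir_mem_levelStab n) (m ^ r) _ h1, sec_pow_of_mem (S.dir_mem_levelStab n) h1,
        S.sec_dir h1]
      congr 1
      by_cases ht : v.take (S.level n) = S.last n
      · rw [ht, S.part_last]
        have := S.level_pos n
        exact ih (L - S.level n) (by omega) _ _ (by simp [hv])
      · rw [blockGroup_pow_eq_one S.two_le (S.part_mem n _ h1 ht), app_one]

theorem gens_finite (n : ℕ) : (S.gens n).Finite := by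
  refine Set.Finite.union ?_ (Set.finite_singleton _)
  refine ((Set.finite_lt_nat (S.blocks n)).image (blockOdo m r)).subset ?_
  rintro _ ⟨i, hi, rfl⟩
  exact ⟨i, hi, rfl⟩

theorem group_fg (n : ℕ) : (S.group n).FG :=
  (Subgroup.fg_iff _).2 ⟨S.gens n, rfl, S.gens_finite n⟩

theorem blockGroup_le_group (n : ℕ) : blockGroup m r (S.blocks n) ≤ S.group n :=
  Subgroup.closure_mono Set.subset_union_left

theorem dir_mem_group (n : ℕ) : S.dir n ∈ S.group n := Subgroup.subset_closure (Or.inr rfl)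

theorem group_le_Gamma (n : ℕ) : S.group n ≤ Gamma m := by
  refine (Subgroup.closure_le _).2 (Set.union_subset ?_ (Set.singleton_subset_iff.2
    (S.dir_mem_Gamma n)))
  exact Subgroup.subset_closure.trans (blockGroup_le_Gamma r (S.blocks n))

theorem derived_le_group (n : ℕ) : S.derived n ≤ S.group n := by
  rw [derived, ← Subgroup.map_subtype_commutator]
  exact Subgroup.map_subtype_le _

theorem relIndex_derived_ne_zero (n : ℕ) : (S.derived n).relIndex (S.group n) ≠ 0 := by
  refine finite_abelianization_of_closure (S.gens_finite n) (e := m ^ r)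
    (Nat.pow_pos S.pos) ?_
  rintro _ (⟨i, _, rfl⟩ | rfl)
  · exact blockOdo_pow_eq_one S.two_le r i
  · exact S.dir_pow_eq_one n

theorem conj_mem_group {n : ℕ} {g x : TreeAut m} (hg : g ∈ S.group n) (hx : x ∈ S.group n) :
    g * x * g⁻¹ ∈ S.group n := mul_mem (mul_mem hg hx) (inv_mem hg)

theorem conj_mem_derived {n : ℕ} {g x : TreeAut m} (hg : g ∈ S.group n) (hx : x ∈ S.derived n) :
    g * x * g⁻¹ ∈ S.derived n :=
  conj_mem_commutator (fun _ hy => S.conj_mem_group hg hy) hx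

theorem sec_mem_group {n : ℕ} {g : TreeAut m} (hg : g ∈ S.group n) :
    ∀ {v : List (Fin m)}, v.length = S.level n → sec g v ∈ S.group (n + 1) := by
  induction hg using Subgroup.closure_induction with
  | mem g hg =>
    intro v hv
    obtain ⟨i, hi, rfl⟩ | rfl := hg
    · rw [sec_blockGroup (blockOdo_mem_blockGroup hi) hv.ge]
      exact one_mem _
    · rw [S.sec_dir hv]
      by_cases h : v = S.last n
      · rw [h, S.part_last]
        exact S.dir_mem_group _
      · exact S.blockGroup_le_group _ (S.part_mem n v hv h)
  | one =>
    intro v _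
    rw [sec_one]
    exact one_mem _
  | mul a b _ _ iha ihb =>
    intro v hv
    rw [sec_mul]
    exact mul_mem (iha (by rwa [length_app])) (ihb hv)
  | inv a _ iha =>
    intro v hv
    rw [sec_inv]
    exact inv_mem (iha (by rwa [length_app]))

theorem sec_depth_mem_group {n : ℕ} (j : ℕ) : ∀ {g : TreeAut m}, g ∈ S.group n →
    ∀ {v : List (Fin m)}, v.length = S.depth n j → sec g v ∈ S.group (n + j) := by
  induction j with
  | zero =>
    intro g hg v hv
    rwa [List.eq_nil_of_length_eq_zero hv, sec_nil]
  | succ j ih =>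
    intro g hg v hv
    rw [depth] at hv
    rw [← List.take_append_drop (S.depth n j) v, sec_append]
    exact S.sec_mem_group (ih hg (by simp only [List.length_take]; omega))
      (by simp only [List.length_drop]; omega)

theorem sec_conj_dir {n : ℕ} {a : TreeAut m} (ha : a ∈ blockGroup m r (S.blocks n))
    {v : List (Fin m)} (hv : v.length = S.level n) :
    sec (a * S.dir n * a⁻¹) v = S.part n (app a⁻¹ v) := by
  have hv' : (app a⁻¹ v).length = S.level n := by rw [length_app, hv]
  rw [sec_mul, sec_mul, sec_blockGroup (inv_mem ha) hv.ge, S.dir_mem_levelStab n _ hv',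
    sec_blockGroup ha hv'.ge, S.sec_dir hv', one_mul, mul_one]

theorem conj_dir_mem_levelStab (n : ℕ) (a : TreeAut m) :
    a * S.dir n * a⁻¹ ∈ levelStab m (S.level n) :=
  (levelStab_normal _).conj_mem _ (S.dir_mem_levelStab n) a

/-- Every vertex stabilizer at level `S.level n` induces all of `S.group (n + 1)` on the subtree
hanging from the vertex. -/
theorem exists_sec_eq {n : ℕ} {g : TreeAut m} (hg : g ∈ S.group (n + 1)) {v : List (Fin m)}
    (hv : v.length = S.level n) : ∃ h ∈ S.group n, app h v = v ∧ sec h v = g := by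
  have key : ∀ s : List (Fin m), s.length = S.level n →
      ∃ h ∈ S.group n, app h v = v ∧ sec h v = S.part n s := by
    intro s hs
    obtain ⟨a, ha, has⟩ := exists_blockGroup_app_eq S.two_le hs hv
    refine ⟨a * S.dir n * a⁻¹, S.conj_mem_group (S.blockGroup_le_group n ha) (S.dir_mem_group n),
      S.conj_dir_mem_levelStab n a v hv, ?_⟩
    rw [S.sec_conj_dir ha hv, ← has, app_inv_app]
  induction hg using Subgroup.closure_induction with
  | mem g hg =>
    obtain ⟨i, hi, rfl⟩ | rfl := hg
    · obtain ⟨s, hs, _, h⟩ := S.exists_part_eq n i hi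
      exact h ▸ key s hs
    · exact S.part_last n ▸ key (S.last n) (S.length_last n)
  | one => exact ⟨1, one_mem _, app_one v, sec_one v⟩
  | mul a b _ _ iha ihb =>
    obtain ⟨x, hx, hxv, hxs⟩ := iha
    obtain ⟨y, hy, hyv, hys⟩ := ihb
    exact ⟨x * y, mul_mem hx hy, by rw [app_mul, hyv, hxv], by rw [sec_mul, hyv, hxs, hys]⟩
  | inv a _ iha =>
    obtain ⟨x, hx, hxv, hxs⟩ := iha
    have h : app x⁻¹ v = v := by
      conv_lhs => rw [← hxv, app_inv_app]
    exact ⟨x⁻¹, inv_mem hx, h, by rw [sec_inv, h, hxs]⟩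

theorem levelTransitive (n : ℕ) : LevelTransitive (S.group n) := by
  suffices h : ∀ (L n : ℕ) (u v : List (Fin m)), u.length = L → v.length = L →
      ∃ g ∈ S.group n, app g u = v from fun u v huv => h _ n u v huv rfl
  intro L
  induction L using Nat.strong_induction_on with
  | _ L ih =>
    intro n u v hu hv
    by_cases hL : L < S.level n
    · let w := List.replicate (S.level n - L) (⟨0, S.pos⟩ : Fin m)
      have hw : w.length = S.level n - L := List.length_replicate
      obtain ⟨a, ha, hauv⟩ := exists_blockGroup_app_eq S.two_le
        (u := u ++ w) (v := v ++ w) (r := r) (k := S.blocks n)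
        (by rw [List.length_append, hw, hu, ← level]; omega)
        (by rw [List.length_append, hw, hv, ← level]; omega)
      refine ⟨a, S.blockGroup_le_group n ha, ?_⟩
      rw [app_append] at hauv
      exact List.append_inj_left hauv (by rw [length_app, hu, hv])
    · have hu1 : (u.take (S.level n)).length = S.level n := by
        simp only [List.length_take]
        omega
      have hv1 : (v.take (S.level n)).length = S.level n := by
        simp only [List.length_take]
        omega
      obtain ⟨a, ha, hauv⟩ := exists_blockGroup_app_eq S.two_le hu1 hv1
      have := S.level_pos n
      obtain ⟨g, hg, hguv⟩ := ih (L - S.level n) (by omega) (n + 1) (u.drop (S.level n))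
        (v.drop (S.level n)) (by simp [hu]) (by simp [hv])
      obtain ⟨h, hh, hhv, hhs⟩ := S.exists_sec_eq hg hv1
      refine ⟨h * a, mul_mem hh (S.blockGroup_le_group n ha), ?_⟩
      rw [← List.take_append_drop (S.level n) u, app_mul, app_append, hauv,
        sec_blockGroup ha hu1.ge, app_one, app_append, hhv, hhs, hguv, List.take_append_drop]

end DirectedSystem

end TreeAut

/-! ### Branching of the derived subgroups -/

namespace TreeAut

variable {m : ℕ}

theorem sec_commutator {N : ℕ} {x y : TreeAut m} (hx : x ∈ levelStab m N)
    (hy : y ∈ levelStab m N) {v : List (Fin m)} (hv : v.length = N) :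
    sec ⁅x, y⁆ v = ⁅sec x v, sec y v⁆ := by
  rw [commutatorElement_def, sec_mul_of_mem _ (inv_mem hy) hv, sec_mul_of_mem _ (inv_mem hx) hv,
    sec_mul_of_mem _ hy hv, sec_inv_of_mem hx hv, sec_inv_of_mem hy hv, commutatorElement_def]

namespace DirectedSystem

variable {r : ℕ} (S : DirectedSystem m r)

include S in
theorem natCast_ne_zero {c : ℕ} (h0 : 0 < c) (hc : c < 5) : (c : ZMod (m ^ r)) ≠ 0 := by
  rw [Ne, ZMod.natCast_eq_zero_iff]
  intro h
  have := Nat.le_of_dvd h0 h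
  have := S.five_le
  omega

theorem part_eq_one_of_ne {n : ℕ} {v : List (Fin m)} (hv : v.length = S.level n)
    (h0 : firstBlock r v ≠ 0) (h1 : firstBlock r v ≠ -1) : S.part n v = 1 :=
  S.part_eq_one n v hv (fun h => h1 (h ▸ S.firstBlock_last n)) h0

theorem part_mem_of_ne {n : ℕ} {v : List (Fin m)} (hv : v.length = S.level n)
    (h1 : firstBlock r v ≠ -1) : S.part n v ∈ blockGroup m r (S.blocks (n + 1)) :=
  S.part_mem n v hv fun h => h1 (h ▸ S.firstBlock_last n)

theorem part_mem_zpowers_of_ne {n : ℕ} {v : List (Fin m)} (hv : v.length = S.level n)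
    (h0 : firstBlock r v ≠ 0) : S.part n v ∈ Subgroup.zpowers (S.dir (n + 1)) := by
  by_cases h : v = S.last n
  · rw [h, S.part_last]
    exact Subgroup.mem_zpowers _
  · rw [S.part_eq_one n v hv h h0]
    exact one_mem _

/-- For the elements `x = b (b ^ e)⁻¹` and `y = b ^ h (b ^ g)⁻¹` of the derived subgroup, where `e`
and `g` add `3` to the first block, and `h` adds `1` and maps the distinguished vertex to `s`, the
section at `v` of the commutator of `x` and `y` is trivial unless `v = s`. -/
theorem commute_part {n : ℕ} {e h g : TreeAut m} {s : List (Fin m)}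
    (he : ∀ v : List (Fin m), r ≤ v.length → firstBlock r (app e⁻¹ v) = firstBlock r v - 3)
    (hh : ∀ v : List (Fin m), r ≤ v.length → firstBlock r (app h⁻¹ v) = firstBlock r v - 1)
    (hg : ∀ v : List (Fin m), r ≤ v.length → firstBlock r (app g⁻¹ v) = firstBlock r v - 3)
    (hs : app h (S.last n) = s) {v : List (Fin m)} (hv : v.length = S.level n) (hvs : v ≠ s) :
    Commute (S.part n v * (S.part n (app e⁻¹ v))⁻¹)
      (S.part n (app h⁻¹ v) * (S.part n (app g⁻¹ v))⁻¹) := by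
  have n1 : (1 : ZMod (m ^ r)) ≠ 0 := by
    exact_mod_cast S.natCast_ne_zero (c := 1) (by omega) (by omega)
  have n2 : (2 : ZMod (m ^ r)) ≠ 0 := by
    exact_mod_cast S.natCast_ne_zero (c := 2) (by omega) (by omega)
  have n3 : (3 : ZMod (m ^ r)) ≠ 0 := by
    exact_mod_cast S.natCast_ne_zero (c := 3) (by omega) (by omega)
  have n4 : (4 : ZMod (m ^ r)) ≠ 0 := by
    exact_mod_cast S.natCast_ne_zero (c := 4) (by omega) (by omega)
  have hr : r ≤ v.length := hv ▸ S.le_level n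
  have le : (app e⁻¹ v).length = S.level n := by rw [length_app, hv]
  have lh : (app h⁻¹ v).length = S.level n := by rw [length_app, hv]
  have lg : (app g⁻¹ v).length = S.level n := by rw [length_app, hv]
  have fe := he v hr
  have fh := hh v hr
  have fg := hg v hr
  by_cases f0 : firstBlock r v = 0
  · rw [f0] at fh fg
    have hlast : app h⁻¹ v ≠ S.last n := fun H => hvs (by rw [← hs, ← H, app_app_inv])
    have e1 : S.part n (app h⁻¹ v) = 1 := S.part_eq_one n _ lh hlast
      (fun H => n1 (by linear_combination fh - H))
    have e2 : S.part n (app g⁻¹ v) = 1 := S.part_eq_one_of_ne lg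
      (fun H => n3 (by linear_combination fg - H)) (fun H => n2 (by linear_combination fg - H))
    rw [e1, e2, inv_one, mul_one]
    exact Commute.one_right _
  by_cases f1 : firstBlock r v = -1
  · rw [f1] at fh fg
    have e1 : S.part n (app h⁻¹ v) = 1 := S.part_eq_one_of_ne lh
      (fun H => n2 (by linear_combination fh - H)) (fun H => n1 (by linear_combination fh - H))
    have e2 : S.part n (app g⁻¹ v) = 1 := S.part_eq_one_of_ne lg
      (fun H => n4 (by linear_combination fg - H)) (fun H => n3 (by linear_combination fg - H))
    rw [e1, e2, inv_one, mul_one]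
    exact Commute.one_right _
  rw [S.part_eq_one_of_ne hv f0 f1, one_mul]
  by_cases f3 : firstBlock r v = 3
  · rw [f3] at fe fh fg
    rw [S.part_eq_one_of_ne lh (fun H => n2 (by linear_combination H - fh))
      (fun H => n3 (by linear_combination H - fh)), one_mul]
    exact blockGroup_commute S.two_le
      (inv_mem (S.part_mem_of_ne le fun H => n1 (by linear_combination H - fe)))
      (inv_mem (S.part_mem_of_ne lg fun H => n1 (by linear_combination H - fg)))
  by_cases f2 : firstBlock r v = 2
  · rw [f2] at fe fh fg
    rw [S.part_eq_one_of_ne lh (fun H => n1 (by linear_combination H - fh))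
      (fun H => n2 (by linear_combination H - fh)), one_mul]
    have h1 := S.part_mem_zpowers_of_ne le fun H => n1 (by linear_combination fe - H)
    have h2 := S.part_mem_zpowers_of_ne lg fun H => n1 (by linear_combination fg - H)
    obtain ⟨c, hc⟩ := h1
    obtain ⟨d, hd⟩ := h2
    rw [← hc, ← hd]
    exact ((Commute.refl _).zpow_zpow c d).inv_inv
  rw [S.part_eq_one_of_ne le (fun H => f3 (by linear_combination H - fe))
    (fun H => f2 (by linear_combination H - fe)), inv_one]
  exact Commute.one_left _

/-- The second derived subgroup contains an element supported on a single subtree, on which it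
acts as the commutator of two of the generators of `S.group (n + 1)`. -/
theorem exists_lift_commutator_mem {n i : ℕ} (hi : i < S.blocks (n + 1)) :
    ∃ s : List (Fin m), s.length = S.level n ∧
      lift s ⁅blockOdo m r i, S.dir (n + 1)⁆ ∈ ⁅S.derived n, S.derived n⁆ := by
  obtain ⟨s, hs, hs0, hsi⟩ := S.exists_part_eq n i hi
  refine ⟨s, hs, ?_⟩
  have hle := S.le_level n
  set b := S.dir n with hb
  have hd : odo m r ∈ blockGroup m r (S.blocks n) :=
    blockOdo_zero (m := m) r ▸ blockOdo_mem_blockGroup (S.blocks_pos n)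
  obtain ⟨h, hh, hhs⟩ := exists_blockGroup_app_eq S.two_le (S.length_last n) hs
  obtain ⟨c, hc⟩ := exists_firstBlock_blockGroup hh
  obtain rfl : c = 1 := by
    have h1 := hc (S.last n) (by rw [S.length_last n]; exact hle)
    rw [hhs, hs0, S.firstBlock_last] at h1
    linear_combination -h1
  have hinv : ∀ {a : TreeAut m} {c : ZMod (m ^ r)},
      (∀ v : List (Fin m), r ≤ v.length → firstBlock r (app a v) = firstBlock r v + c) →
      ∀ v : List (Fin m), r ≤ v.length → firstBlock r (app a⁻¹ v) = firstBlock r v - c := by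
    intro a c h v hv
    have := h (app a⁻¹ v) (by rwa [length_app])
    rw [app_app_inv] at this
    rw [this, add_sub_cancel_right]
  have he' : ∀ v : List (Fin m), r ≤ v.length →
      firstBlock r (app (odo m r ^ 3) v) = firstBlock r v + 3 := fun v hv => by
    simpa using firstBlock_odo_pow 3 hv
  have hg' : ∀ v : List (Fin m), r ≤ v.length →
      firstBlock r (app (h * odo m r ^ 2) v) = firstBlock r v + 3 := fun v hv => by
    rw [app_mul, hc _ (by rwa [length_app]), firstBlock_odo_pow 2 hv]
    push_cast
    ring
  -- the shifts by `3` of the first block leave room for the supports of the factors to meet, in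
  -- sections that do not commute, at the vertex `s` only
  set e := odo m r ^ 3 with hedef
  set g := h * odo m r ^ 2 with hgdef
  have he : e ∈ blockGroup m r (S.blocks n) := pow_mem hd 3
  have hg : g ∈ blockGroup m r (S.blocks n) := mul_mem hh (pow_mem hd 2)
  have hG := S.blockGroup_le_group n
  set x := b * (e * b * e⁻¹)⁻¹ with hx
  set y := h * b * h⁻¹ * (g * b * g⁻¹)⁻¹ with hy
  have hxd : x ∈ S.derived n := by
    have : x = ⁅b, e⁆ := by
      rw [hx, commutatorElement_def]
      group
    rw [this]
    exact Subgroup.commutator_mem_commutator (S.dir_mem_group n) (hG he)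
  have hyd : y ∈ S.derived n := by
    have : y = h * ⁅b, odo m r ^ 2⁆ * h⁻¹ := by
      rw [hy, hgdef, commutatorElement_def]
      group
    rw [this]
    exact S.conj_mem_derived (hG hh)
      (Subgroup.commutator_mem_commutator (S.dir_mem_group n) (hG (pow_mem hd 2)))
  have hxs : x ∈ levelStab m (S.level n) :=
    mul_mem (S.dir_mem_levelStab n) (inv_mem (S.conj_dir_mem_levelStab n e))
  have hys : y ∈ levelStab m (S.level n) :=
    mul_mem (S.conj_dir_mem_levelStab n h) (inv_mem (S.conj_dir_mem_levelStab n g))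
  have hsx : ∀ v : List (Fin m), v.length = S.level n →
      sec x v = S.part n v * (S.part n (app e⁻¹ v))⁻¹ := fun v hv => by
    rw [hx, sec_mul_of_mem _ (inv_mem (S.conj_dir_mem_levelStab n e)) hv,
      sec_inv_of_mem (S.conj_dir_mem_levelStab n e) hv, S.sec_dir hv, S.sec_conj_dir he hv]
  have hsy : ∀ v : List (Fin m), v.length = S.level n →
      sec y v = S.part n (app h⁻¹ v) * (S.part n (app g⁻¹ v))⁻¹ := fun v hv => by
    rw [hy, sec_mul_of_mem _ (inv_mem (S.conj_dir_mem_levelStab n g)) hv,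
      sec_inv_of_mem (S.conj_dir_mem_levelStab n g) hv, S.sec_conj_dir hh hv, S.sec_conj_dir hg hv]
  have key : ⁅x, y⁆ = lift s ⁅blockOdo m r i, S.dir (n + 1)⁆ := by
    refine levelStab_ext S.pos ?_ (hs ▸ lift_mem_levelStab s _) fun v hv => ?_
    · rw [commutatorElement_def]
      exact mul_mem (mul_mem (mul_mem hxs hys) (inv_mem hxs)) (inv_mem hys)
    · rw [sec_commutator hxs hys hv, hsx v hv, hsy v hv]
      by_cases hvs : v = s
      · subst hvs
        have n2 : (2 : ZMod (m ^ r)) ≠ 0 := by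
          exact_mod_cast S.natCast_ne_zero (c := 2) (by omega) (by omega)
        have n3 : (3 : ZMod (m ^ r)) ≠ 0 := by
          exact_mod_cast S.natCast_ne_zero (c := 3) (by omega) (by omega)
        have hr : r ≤ v.length := hv ▸ hle
        have fe := hinv he' v hr
        have fg := hinv hg' v hr
        rw [hs0] at fe fg
        have e1 : S.part n (app e⁻¹ v) = 1 := S.part_eq_one_of_ne ((length_app _ _).trans hv)
          (fun H => n3 (by linear_combination fe - H)) (fun H => n2 (by linear_combination fe - H))
        have e2 : S.part n (app g⁻¹ v) = 1 := S.part_eq_one_of_ne ((length_app _ _).trans hv)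
          (fun H => n3 (by linear_combination fg - H)) (fun H => n2 (by linear_combination fg - H))
        have e3 : app h⁻¹ v = S.last n := by rw [← hhs, app_inv_app]
        rw [e1, e2, e3, S.part_last, hsi, inv_one, mul_one, mul_one, sec_lift_self]
      · rw [sec_lift_of_ne _ (hv.trans hs.symm) hvs]
        exact (S.commute_part (hinv he') (hinv hc) (hinv hg') hhs hv hvs).commutator_eq
  rw [← key]
  exact Subgroup.commutator_mem_commutator hxd hyd

/-- The second derived subgroup of `S.group n` contains the derived subgroup of `S.group (n + 1)`
acting on the subtree hanging from any vertex of level `S.level n`. -/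
theorem derived_le_comap_lift {n : ℕ} {v : List (Fin m)} (hv : v.length = S.level n) :
    S.derived (n + 1) ≤ ⁅S.derived n, S.derived n⁆.comap (lift v) := by
  let C : Subgroup (TreeAut m) := ⨅ w : {w : List (Fin m) // w.length = S.level n},
    ⁅S.derived n, S.derived n⁆.comap (lift w.1)
  have hC : ∀ x, x ∈ C ↔ ∀ w : List (Fin m), w.length = S.level n →
      lift w x ∈ ⁅S.derived n, S.derived n⁆ := by
    intro x
    simp only [C, Subgroup.mem_iInf, Subgroup.mem_comap, Subtype.forall]
  have hconj : ∀ {g x : TreeAut m}, g ∈ S.group n → x ∈ ⁅S.derived n, S.derived n⁆ →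
      g * x * g⁻¹ ∈ ⁅S.derived n, S.derived n⁆ := fun hg hx =>
    conj_mem_commutator (fun _ hy => S.conj_mem_derived hg hy) hx
  have hD : ∀ i < S.blocks (n + 1), ⁅blockOdo m r i, S.dir (n + 1)⁆ ∈ C := by
    intro i hi
    rw [hC]
    intro w hw
    obtain ⟨s, hs, h⟩ := S.exists_lift_commutator_mem hi
    obtain ⟨a, ha, has⟩ := exists_blockGroup_app_eq S.two_le hs hw
    have h1 := hconj (S.blockGroup_le_group n ha) h
    rwa [conj_lift, has, sec_blockGroup ha hs.ge, one_mul, inv_one, mul_one] at h1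
  have hle : S.derived (n + 1) ≤ C := by
    refine commutator_closure_le (fun g hg x hx => ?_) ?_
    · rw [hC] at hx ⊢
      intro w hw
      obtain ⟨h, hh, hhw, hhs⟩ := S.exists_sec_eq hg hw
      have h1 := hconj hh (hx w hw)
      rwa [conj_lift, hhw, hhs] at h1
    · rintro _ (⟨i, hi, rfl⟩ | rfl) _ (⟨j, hj, rfl⟩ | rfl)
      · rw [commutatorElement_eq_one_iff_mul_comm.2 (blockOdo_commute S.two_le r i j)]
        exact one_mem _
      · exact hD i hi
      · rw [← commutatorElement_inv]
        exact inv_mem (hD j hj)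
      · rw [commutatorElement_self]
        exact one_mem _
  exact fun x hx => (hC x).1 (hle hx) v hv

theorem derived_le_comap_lift_depth {n : ℕ} (j : ℕ) : ∀ {v : List (Fin m)},
    v.length = S.depth n j → S.derived (n + j) ≤ (S.derived n).comap (lift v) := by
  induction j with
  | zero =>
    intro v hv x hx
    have : lift v x = x := ext_app fun w => by
      rw [List.eq_nil_of_length_eq_zero hv]
      simpa using app_lift_append [] x w
    rwa [Subgroup.mem_comap, this]
  | succ j ih =>
    intro v hv x hx
    rw [depth] at hv
    have h1 := S.derived_le_comap_lift (n := n + j) (v := v.drop (S.depth n j))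
      (by simp only [List.length_drop]; omega) hx
    have h2 : lift (v.drop (S.depth n j)) x ∈ S.derived (n + j) :=
      Subgroup.commutator_mono (S.derived_le_group _) (S.derived_le_group _) h1
    have h3 := ih (v := v.take (S.depth n j)) (by simp only [List.length_take]; omega) h2
    rwa [Subgroup.mem_comap, ← lift_append, List.take_append_drop] at h3

/-- The product of the derived subgroups of `S.group (n + j)` over the vertices of level
`S.depth n j`. -/
def branching (n j : ℕ) : Subgroup (TreeAut m) :=
  levelProd (S.depth n j) fun _ => S.derived (n + j)

theorem branching_le_levelRist (n j : ℕ) :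
    S.branching n j ≤ levelRist (S.group n) (S.depth n j) :=
  levelProd_le_levelRist S.pos fun _ hv =>
    (S.derived_le_comap_lift_depth j hv).trans (Subgroup.comap_mono (S.derived_le_group n))

theorem relIndex_branching_ne_zero (n j : ℕ) :
    (S.branching n j).relIndex (S.group n) ≠ 0 :=
  relIndex_levelProd_ne_zero (S.relIndex_derived_ne_zero (n + j)) fun _ hg _ hv =>
    S.sec_depth_mem_group j hg hv

/-- Every non-trivial subgroup normalized by `S.group n` contains some `S.branching n j`. -/
theorem exists_branching_le {n : ℕ} {N : Subgroup (TreeAut m)} (hN : N ≠ ⊥)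
    (hconj : ∀ g ∈ S.group n, ∀ x ∈ N, g * x * g⁻¹ ∈ N) : ∃ j, S.branching n j ≤ N := by
  obtain ⟨⟨g, hg⟩, hg1⟩ := N.ne_bot_iff_exists_ne_one.1 hN
  obtain ⟨w, hw⟩ : ∃ w, app g w ≠ w := by
    by_contra! H
    exact hg1 (Subtype.ext (ext_app H))
  obtain ⟨v, hv, hgv⟩ : ∃ v, v.length = S.depth n w.length ∧ app g v ≠ v := by
    by_contra! H
    exact hw (levelStab_anti (S.le_depth n w.length) S.pos (show g ∈ levelStab m _ from H) w rfl)
  set j := w.length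
  have h1 : ⁅S.derived (n + j), S.derived (n + j)⁆ ≤ N.comap (lift v) :=
    commutator_le_comap_lift hg hgv fun a ha => hconj _
      (S.derived_le_group n (S.derived_le_comap_lift_depth j hv ha))
  have h2 : S.derived (n + (j + 1)) ≤ N.comap (lift (v ++ S.last (n + j))) := by
    intro x hx
    rw [Subgroup.mem_comap, lift_append]
    exact h1 (S.derived_le_comap_lift (S.length_last (n + j)) hx)
  have hl : (v ++ S.last (n + j)).length = S.depth n (j + 1) := by
    rw [List.length_append, hv, S.length_last]
    rfl
  -- conjugation by `S.group n` moves the last inclusion to all the vertices of the level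
  refine ⟨j + 1, levelProd_le S.pos fun u hu x hx => ?_⟩
  obtain ⟨h, hh, hhu⟩ := S.levelTransitive n _ u (hl.trans hu.symm)
  have hs := S.sec_depth_mem_group (j + 1) hh hl
  have h3 := hconj h hh _ (h2 (S.conj_mem_derived (inv_mem hs) hx))
  rw [conj_lift, hhu] at h3
  rw [Subgroup.mem_comap]
  convert h3 using 2
  group

end DirectedSystem

end TreeAut

/-! ### The groups of a directed system and their closures -/

namespace TreeAut

variable {m : ℕ}

theorem relIndex_ne_zero_of_le {G : Type*} [Group G] {M N K : Subgroup G} (h : M ≤ N)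
    (hM : M.relIndex K ≠ 0) : N.relIndex K ≠ 0 :=
  fun H => hM (Subgroup.relIndex_eq_zero_of_le_left h H)

theorem ne_bot_of_relIndex_ne_zero {G : Type*} [Group G] {M K : Subgroup G} [Infinite K]
    (hM : M.relIndex K ≠ 0) : M ≠ ⊥ := by
  rintro rfl
  exact hM (by rw [Subgroup.relIndex_bot_left, Nat.card_eq_zero_of_infinite])

theorem isBranch_of_relIndex_ne_zero (hm : 2 ≤ m) {G : Subgroup (TreeAut m)}
    (hG : LevelTransitive G)
    (h : ∀ n, ∃ M : Subgroup (TreeAut m), M ≤ levelRist G n ∧ M.relIndex G ≠ 0) : IsBranch G := by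
  have := infinite_of_levelTransitive hm hG
  refine ⟨hG, fun n => ?_⟩
  obtain ⟨M, hM, hMG⟩ := h n
  have h1 := relIndex_ne_zero_of_le hM hMG
  exact ⟨ne_bot_of_relIndex_ne_zero h1, ⟨h1⟩⟩

theorem conj_mem_map_subtype {G : Type*} [Group G] {H : Subgroup G} {N : Subgroup H}
    (hN : N.Normal) {g : G} (hg : g ∈ H) {x : G} (hx : x ∈ N.map H.subtype) :
    g * x * g⁻¹ ∈ N.map H.subtype := by
  obtain ⟨y, hy, rfl⟩ := hx
  exact ⟨_, hN.conj_mem y hy ⟨g, hg⟩, rfl⟩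

theorem map_subtype_ne_bot {G : Type*} [Group G] {H : Subgroup G} {N : Subgroup H}
    (hN : N ≠ ⊥) : N.map H.subtype ≠ ⊥ := fun h =>
  hN ((Subgroup.map_eq_bot_iff_of_injective N H.subtype_injective).1 h)

theorem finiteIndex_of_relIndex_map_subtype {G : Type*} [Group G] {H : Subgroup G}
    {N : Subgroup H} (h : (N.map H.subtype).relIndex H ≠ 0) : N.FiniteIndex := by
  have h1 : (N.map H.subtype).subgroupOf H = N :=
    Subgroup.comap_map_eq_self_of_injective H.subtype_injective N
  exact ⟨h1 ▸ h⟩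

namespace DirectedSystem

variable {r : ℕ} (S : DirectedSystem m r) (n : ℕ)

theorem isBranch_group : IsBranch (S.group n) :=
  isBranch_of_relIndex_ne_zero S.two_le (S.levelTransitive n) fun j =>
    ⟨S.branching n j, (S.branching_le_levelRist n j).trans (levelRist_anti _ (S.le_depth n j)),
      S.relIndex_branching_ne_zero n j⟩

theorem isJustInfinite_group : IsJustInfinite (S.group n) := by
  refine ⟨infinite_of_levelTransitive S.two_le (S.levelTransitive n), fun N hN hN1 => ?_⟩
  obtain ⟨j, hj⟩ := S.exists_branching_le (n := n) (map_subtype_ne_bot hN1)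
    fun g hg x hx => conj_mem_map_subtype hN hg hx
  exact finiteIndex_of_relIndex_map_subtype
    (relIndex_ne_zero_of_le hj (S.relIndex_branching_ne_zero n j))

theorem closure_le_Gamma : (S.group n).topologicalClosure ≤ Gamma m :=
  Subgroup.topologicalClosure_minimal _ (S.group_le_Gamma n) isClosed_Gamma

theorem levelTransitive_closure : LevelTransitive (S.group n).topologicalClosure := by
  intro u v huv
  obtain ⟨g, hg, h⟩ := S.levelTransitive n u v huv
  exact ⟨g, Subgroup.le_topologicalClosure _ hg, h⟩

/-- The rigid level stabilizers of the closure contain closed subgroups which contain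
`S.branching n j`. -/
theorem isBranch_closure : IsBranch (S.group n).topologicalClosure := by
  set H := (S.group n).topologicalClosure with hH
  have hHc : IsClosed (H : Set (TreeAut m)) := Subgroup.isClosed_topologicalClosure _
  have hle : ∀ j, S.branching n j ≤ levelProd (S.depth n j) fun v => H.comap (lift v) :=
    fun j g hg => ⟨hg.1, fun v hv => Subgroup.le_topologicalClosure _
      (S.derived_le_group n (S.derived_le_comap_lift_depth j hv (hg.2 v hv)))⟩
  exact isBranch_of_relIndex_ne_zero S.two_le (S.levelTransitive_closure n) fun j =>
    ⟨levelProd (S.depth n j) fun v => H.comap (lift v),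
      (levelProd_le_levelRist S.pos fun _ _ => le_rfl).trans (levelRist_anti _ (S.le_depth n j)),
      relIndex_topologicalClosure_ne_zero
        (isClosed_levelProd _ fun v => hHc.preimage (continuous_lift v))
        (relIndex_ne_zero_of_le (hle j) (S.relIndex_branching_ne_zero n j))⟩

theorem isJustInfiniteProfinite_closure :
    IsJustInfiniteProfinite (S.group n).topologicalClosure := by
  set H := (S.group n).topologicalClosure with hH
  have hHc : IsClosed (H : Set (TreeAut m)) := Subgroup.isClosed_topologicalClosure _
  refine ⟨isProfinite_of_isClosed hHc,
    infinite_of_levelTransitive S.two_le (S.levelTransitive_closure n), fun N hN hNc hN1 => ?_⟩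
  have hNc' : IsClosed (N.map H.subtype : Set (TreeAut m)) :=
    hHc.isClosedEmbedding_subtypeVal.isClosedMap _ hNc
  obtain ⟨j, hj⟩ := S.exists_branching_le (n := n) (map_subtype_ne_bot hN1)
    fun g hg x hx => conj_mem_map_subtype hN (Subgroup.le_topologicalClosure _ hg) hx
  have := finiteIndex_of_relIndex_map_subtype (relIndex_topologicalClosure_ne_zero hNc'
    (relIndex_ne_zero_of_le hj (S.relIndex_branching_ne_zero n j)))
  exact Subgroup.isOpen_of_isClosed_of_finiteIndex N hNc

theorem isProP_closure {p j : ℕ} (hp : p.Prime) (hm : m = p ^ j) :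
    IsProP p (S.group n).topologicalClosure :=
  isProP_of_isClosed hp hm (Subgroup.isClosed_topologicalClosure _) (S.closure_le_Gamma n)

/-- `S.group n` acts on the level `S.level n` as a transitive abelian group, hence regularly. -/
theorem relIndex_levelStab_level_le :
    (levelStab m (S.level n)).relIndex (S.group n) ≤ m ^ S.level n := by
  have hd : S.derived n ≤ levelStab m (S.level n) := by
    refine commutator_closure_le (fun g _ x hx => (levelStab_normal _).conj_mem x hx g) ?_
    have hb : ∀ y, ⁅S.dir n, y⁆ ∈ levelStab m (S.level n) := fun y => by
      rw [commutatorElement_def, mul_assoc, mul_assoc, ← mul_assoc y]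
      exact mul_mem (S.dir_mem_levelStab n)
        ((levelStab_normal _).conj_mem _ (inv_mem (S.dir_mem_levelStab n)) y)
    rintro _ (⟨i, _, rfl⟩ | rfl) y hy
    · obtain ⟨j, _, rfl⟩ | rfl := hy
      · rw [commutatorElement_eq_one_iff_mul_comm.2 (blockOdo_commute S.two_le r i j)]
        exact one_mem _
      · rw [← commutatorElement_inv]
        exact inv_mem (hb _)
    · exact hb y
  have hcomm : ∀ g ∈ S.group n, ∀ h ∈ S.group n, ∀ v : List (Fin m), v.length = S.level n →
      app g (app h v) = app h (app g v) := by
    intro g hg h hh v hv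
    have h1 := hd (Subgroup.commutator_mem_commutator hg hh) (app (h * g) v)
      (by rw [length_app, hv])
    rw [← app_mul] at h1
    have h2 : ⁅g, h⁆ * (h * g) = g * h := by
      rw [commutatorElement_def]
      group
    rwa [h2] at h1
  rw [← card_level m (S.level n)]
  refine relIndex_levelStab_le (fun g => ⟨app g.1 (S.last n), by
    rw [length_app, S.length_last]; rfl⟩) fun g h hgh v hv => ?_
  have hgh' : app g.1 (S.last n) = app h.1 (S.last n) := congrArg Subtype.val hgh
  obtain ⟨a, ha, rfl⟩ := S.levelTransitive n (S.last n) v ((S.length_last n).trans hv.symm)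
  rw [hcomm _ g.2 _ ha _ (S.length_last n), hgh', ← hcomm _ h.2 _ ha _ (S.length_last n)]

theorem relIndex_levelStab_depth_le (j : ℕ) :
    (levelStab m (S.depth n (j + 1))).relIndex (S.group n) ≤
      m ^ (m ^ S.depth n j * (1 + S.level (n + j))) := by
  have h1 := relIndex_levelStab_add_le (N := S.depth n j) (M := S.level (n + j))
    (fun g hg v hv => S.sec_depth_mem_group (n := n) j hg hv)
  have h2 : (levelStab m (S.depth n j)).relIndex (S.group n) ≤ m ^ m ^ S.depth n j :=
    (Subgroup.relIndex_le_of_le_right (S.group_le_Gamma n)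
      (relIndex_levelStab_pos _ _).ne').trans (relIndex_levelStab_Gamma_le S.two_le _)
  calc _ ≤ _ := h1
    _ ≤ m ^ m ^ S.depth n j * (m ^ S.level (n + j)) ^ m ^ S.depth n j :=
        Nat.mul_le_mul h2 (Nat.pow_le_pow_left (S.relIndex_levelStab_level_le _) _)
    _ = _ := by rw [← pow_mul, ← pow_add]; congr 1; ring

/-- Along the levels `S.depth n (j + 1)` the ratio of logarithms of indices is at most
`m (1 + l) / m ^ l`, where `l = S.level (n + j)` tends to infinity. -/
theorem tendsto_log_relIndex_div :
    Tendsto (fun j => Real.log ((levelStab m (S.depth n (j + 1))).relIndex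
        (S.group n).topologicalClosure) /
      Real.log ((levelStab m (S.depth n (j + 1))).relIndex (Gamma m))) atTop (𝓝 0) := by
  have hm := S.two_le
  have hm' : (1 : ℝ) < m := by exact_mod_cast hm
  have hm0 : (0 : ℝ) < m := by linarith
  have hlog : 0 < Real.log m := Real.log_pos hm'
  have hbound : ∀ j, Real.log ((levelStab m (S.depth n (j + 1))).relIndex
        (S.group n).topologicalClosure) /
      Real.log ((levelStab m (S.depth n (j + 1))).relIndex (Gamma m)) ≤
      m * ((S.level (n + j) : ℝ) ^ 0 / (m : ℝ) ^ S.level (n + j) +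
        (S.level (n + j) : ℝ) ^ 1 / (m : ℝ) ^ S.level (n + j)) := by
    intro j
    have hl := S.level_pos (n + j)
    have hnum : Real.log ((levelStab m (S.depth n (j + 1))).relIndex
        (S.group n).topologicalClosure) ≤
        (m : ℝ) ^ S.depth n j * (1 + S.level (n + j)) * Real.log m := by
      have h1 := (relIndex_levelStab_topologicalClosure (S.group n) _).trans
        (S.relIndex_levelStab_depth_le n j)
      have h2 := Real.log_le_log (Nat.cast_pos.2 (relIndex_levelStab_pos _ _))
        (Nat.cast_le (α := ℝ).2 h1)
      rw [Nat.cast_pow, Real.log_pow] at h2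
      exact_mod_cast h2
    have hden : (m : ℝ) ^ (S.depth n j + (S.level (n + j) - 1)) * Real.log m ≤
        Real.log ((levelStab m (S.depth n (j + 1))).relIndex (Gamma m)) := by
      have h1 := le_relIndex_levelStab_succ_Gamma hm (S.depth n j + (S.level (n + j) - 1))
      rw [show S.depth n j + (S.level (n + j) - 1) + 1 = S.depth n (j + 1) by
        rw [depth]; omega] at h1
      have h2 := Real.log_le_log (by positivity) (Nat.cast_le (α := ℝ).2 h1)
      rw [Nat.cast_pow, Real.log_pow] at h2
      exact_mod_cast h2
    refine (div_le_div₀ (by positivity) hnum (by positivity) hden).trans (le_of_eq ?_)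
    obtain ⟨l, hl'⟩ : ∃ l, S.level (n + j) = l + 1 := ⟨S.level (n + j) - 1, by omega⟩
    rw [hl', Nat.add_sub_cancel, pow_add, pow_succ]
    field_simp
  have hlev : Tendsto (fun j => S.level (n + j)) atTop atTop :=
    tendsto_atTop_mono (fun j => Nat.le_mul_of_pos_left _ S.r_pos)
      (S.tendsto_blocks.comp (tendsto_atTop_mono (fun j => Nat.le_add_left j n) tendsto_id))
  have hlim := (((tendsto_pow_const_div_const_pow_of_one_lt 0 hm').comp hlev).add
    ((tendsto_pow_const_div_const_pow_of_one_lt 1 hm').comp hlev)).const_mul (m : ℝ)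
  rw [add_zero, mul_zero] at hlim
  exact tendsto_of_tendsto_of_tendsto_of_le_of_le tendsto_const_nhds hlim
    (fun j => div_nonneg (Real.log_natCast_nonneg _) (Real.log_natCast_nonneg _)) hbound

theorem tendsto_depth : Tendsto (fun j => S.depth n (j + 1)) atTop atTop :=
  tendsto_atTop_mono (fun j => (Nat.le_succ j).trans (S.le_depth n (j + 1))) tendsto_id

theorem hdim_closure : hdim (S.group n).topologicalClosure = 0 :=
  hdim_eq_zero (S.tendsto_depth n) (S.tendsto_log_relIndex_div n)

theorem metricHdim_closure (hm : 2 ≤ m) : metricHdim hm (S.group n).topologicalClosure = 0 :=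
  metricHdim_eq_zero hm (S.tendsto_depth n) (S.tendsto_log_relIndex_div n)

end DirectedSystem

end TreeAut

/-! ### Words all of whose letters are the last or the first one -/

namespace TreeAut

variable {m : ℕ}

theorem digitValue_replicate_last (hm : 0 < m) (l : ℕ) :
    digitValue (List.replicate l (⟨m - 1, by omega⟩ : Fin m)) + 1 = m ^ l := by
  induction l with
  | zero => rfl
  | succ l ih =>
    rw [List.replicate_succ, digitValue_cons, pow_succ', ← ih, mul_add]
    dsimp only
    omega

theorem firstBlock_replicate_last (hm : 0 < m) {r l : ℕ} (h : r ≤ l) :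
    firstBlock r (List.replicate l (⟨m - 1, by omega⟩ : Fin m)) = -1 := by
  have h1 := congrArg (Nat.cast (R := ZMod (m ^ r))) (digitValue_replicate_last hm r)
  rw [ZMod.natCast_self, Nat.cast_add, Nat.cast_one] at h1
  rw [firstBlock, List.take_replicate, min_eq_left h]
  exact eq_neg_of_add_eq_zero_left h1

theorem digitValue_eq_zero {v : List (Fin m)} (h : ∀ x ∈ v, x.val = 0) : digitValue v = 0 := by
  induction v with
  | nil => rfl
  | cons x v ih =>
    rw [digitValue_cons, h x (by simp), ih fun y hy => h y (by simp [hy]), mul_zero,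
      add_zero]

/-! ### The staircase groups -/

theorem lexIndex_eq_foldl {q : ℕ} (w : List (Fin q)) :
    lexIndex w = (w.map Fin.val).foldl (fun k x => k * q + x) 0 := by
  simp [lexIndex, List.map_eq_flatMap]

theorem lexIndex_eq_digitValue {q : ℕ} (w : List (Fin q)) :
    lexIndex w = digitValue w.reverse := by
  induction w using List.reverseRecOn with
  | nil => rfl
  | append_singleton w x ih =>
    rw [lexIndex_eq_foldl] at ih ⊢
    rw [List.map_append, List.foldl_append, List.reverse_append, ih]
    simp [digitValue_cons]
    ring

theorem lexIndex_cons {q : ℕ} (x : Fin q) (w : List (Fin q)) :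
    lexIndex (x :: w) = x * q ^ w.length + lexIndex w := by
  rw [lexIndex_eq_digitValue, lexIndex_eq_digitValue, digitValue, List.reverse_cons,
    List.map_append, Nat.ofDigits_append, ← digitValue]
  simp
  ring

theorem lexIndex_injOn {q : ℕ} (hq : 2 ≤ q) {v w : List (Fin q)} (hl : v.length = w.length)
    (h : lexIndex v = lexIndex w) : v = w := by
  rw [lexIndex_eq_digitValue, lexIndex_eq_digitValue] at h
  exact List.reverse_injective (eq_of_digitValue_modEq hq (r := w.length) (by simp [hl]) (by simp)
    (h ▸ Nat.ModEq.refl _))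

theorem lexIndex_lt {q : ℕ} (hq : 2 ≤ q) (v : List (Fin q)) : lexIndex v < q ^ v.length := by
  rw [lexIndex_eq_digitValue, ← List.length_reverse]
  exact digitValue_lt hq _

theorem exists_lexIndex_eq {q : ℕ} (hq : 2 ≤ q) {l i : ℕ} (hi : i < q ^ l) :
    ∃ v : List (Fin q), v.length = l ∧ lexIndex v = i := by
  have hinj : Function.Injective fun v : {v : List (Fin q) // v.length = l} =>
      (⟨lexIndex v.1, by have := lexIndex_lt hq v.1; rwa [v.2] at this⟩ : Fin (q ^ l)) :=
    fun v w h => Subtype.ext (lexIndex_injOn hq (v.2.trans w.2.symm) (congrArg Fin.val h))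
  obtain ⟨v, hv⟩ := (hinj.bijective_of_nat_card_le (by rw [card_level, Nat.card_fin])).2 ⟨i, hi⟩
  exact ⟨v.1, v.2, congrArg Fin.val hv⟩

theorem lexIndex_replicate_last {q : ℕ} (hq : 0 < q) (l : ℕ) :
    lexIndex (List.replicate l (⟨q - 1, by omega⟩ : Fin q)) = q ^ l - 1 := by
  rw [lexIndex_eq_digitValue, List.reverse_replicate, ← digitValue_replicate_last hq l,
    Nat.add_sub_cancel]

/-- The first `q ^ (l - 1)` words of length `l` in the lexicographical order have first letter
`0`. -/
theorem firstBlock_eq_zero_of_lexIndex_lt {q l : ℕ} {v : List (Fin q)} (hv : v.length = l)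
    (hl : 0 < l) (h : lexIndex v < q ^ (l - 1)) : firstBlock 1 v = 0 := by
  obtain ⟨x, w, rfl⟩ := List.exists_cons_of_length_pos (hv ▸ hl)
  rw [lexIndex_cons, show w.length = l - 1 by simp at hv; omega] at h
  have hx : x.val = 0 := by
    by_contra hx
    have := Nat.le_mul_of_pos_left (q ^ (l - 1)) (Nat.pos_of_ne_zero hx)
    omega
  rw [firstBlock, digitValue_eq_zero (by simpa using hx), Nat.cast_zero]

theorem diagRot_eq_blockOdo (q i : ℕ) : diagRot q i = blockOdo q 1 i := by
  rw [diagRot, blockOdo]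
  congr
  funext v
  rw [blockLabel, odoLabel, one_mul, List.length_drop]
  rcases lt_trichotomy v.length i with h | h | h
  · rw [if_neg h.ne, if_neg (by omega)]
  · rw [if_pos h, if_pos h.ge, if_pos ⟨by omega, by simp [List.drop_eq_nil_of_le h.le]⟩]
  · rw [if_neg h.ne', if_pos h.le, if_neg fun H => by omega]

theorem le_staircaseLevel {q : ℕ} (hq : 5 ≤ q) (n : ℕ) : n + 2 ≤ staircaseLevel q n := by
  induction n with
  | zero => exact le_rfl
  | succ n ih =>
    rw [staircaseLevel]
    obtain ⟨l, hl⟩ : ∃ l, staircaseLevel q n = l + 2 := ⟨staircaseLevel q n - 2, by omega⟩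
    have h1 : l < q ^ l := Nat.lt_pow_self (by omega)
    have h2 := Nat.mul_le_mul hq h1
    rw [hl, show l + 2 - 1 = l + 1 by omega, pow_succ']
    omega

/-- The staircase automorphisms as a directed system with blocks of one letter. -/
def staircaseSystem (q : ℕ) (hq : 5 ≤ q) : DirectedSystem q 1 where
  blocks := staircaseLevel q
  dir := staircase q
  part n w := if lexIndex w < q ^ (staircaseLevel q n - 1) then diagRot q (lexIndex w)
    else if lexIndex w = q ^ staircaseLevel q n - 1 then staircase q (n + 1) else 1
  last n := List.replicate (staircaseLevel q n) ⟨q - 1, by omega⟩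
  two_le := by omega
  five_le := by rwa [pow_one]
  blocks_pos n := by
    have := le_staircaseLevel hq n
    omega
  tendsto_blocks := tendsto_atTop_mono
    (fun n => (Nat.le_add_right n 2).trans (le_staircaseLevel hq n)) tendsto_id
  app_dir_append n v u hv := by
    have := le_staircaseLevel hq n
    exact staircase_app_append q n (by omega) v u (by rw [hv, one_mul])
  length_last n := by rw [List.length_replicate, one_mul]
  firstBlock_last n := by
    have := le_staircaseLevel hq n
    exact firstBlock_replicate_last (by omega) (by omega)
  part_last n := by
    have := le_staircaseLevel hq n
    have h1 : q ^ staircaseLevel q n = q * q ^ (staircaseLevel q n - 1) := by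
      rw [← pow_succ']
      congr 1
      omega
    have h2 : 0 < q ^ (staircaseLevel q n - 1) := Nat.pow_pos (by omega)
    have h3 := Nat.mul_le_mul_right (q ^ (staircaseLevel q n - 1)) hq
    rw [lexIndex_replicate_last (by omega), if_neg (by omega), if_pos rfl]
  part_mem n v hv hlast := by
    split_ifs with h1 h2
    · exact diagRot_eq_blockOdo q _ ▸ blockOdo_mem_blockGroup h1
    · refine absurd (lexIndex_injOn (by omega) ?_ ?_) hlast
      · rw [hv, List.length_replicate, one_mul]
      · rw [h2, lexIndex_replicate_last (by omega)]
    · exact one_mem _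
  part_eq_one n v hv hlast h0 := by
    have := le_staircaseLevel hq n
    rw [one_mul] at hv
    rw [if_neg fun h => h0 (firstBlock_eq_zero_of_lexIndex_lt hv (by omega) h), if_neg]
    refine fun h => hlast (lexIndex_injOn (by omega) ?_ ?_)
    · rw [hv, List.length_replicate]
    · rw [h, lexIndex_replicate_last (by omega)]
  exists_part_eq n i hi := by
    have := le_staircaseLevel hq n
    have hi' : i < q ^ (staircaseLevel q n - 1) := hi
    obtain ⟨v, hv, rfl⟩ := exists_lexIndex_eq (q := q) (by omega)
      (hi'.trans_le (Nat.pow_le_pow_right (by omega) (Nat.sub_le (staircaseLevel q n) 1)))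
    exact ⟨v, by rw [hv, one_mul], firstBlock_eq_zero_of_lexIndex_lt hv (by omega) hi',
      by rw [if_pos hi', diagRot_eq_blockOdo]⟩

theorem staircaseSystem_group (q : ℕ) (hq : 5 ≤ q) (n : ℕ) :
    (staircaseSystem q hq).group n = staircaseGroup q n := by
  rw [DirectedSystem.group, DirectedSystem.gens, staircaseGroup, diagGroup,
    Subgroup.closure_union, Subgroup.closure_union, Subgroup.closure_eq]
  simp only [diagRot_eq_blockOdo]
  rfl

/-! ### A directed system with blocks of three letters -/

/-- The labels of the directed automorphisms of `threeLetterSystem`. With `l = 3 (n + 2)`, the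
labels are trivial above level `l`; below a vertex `w` of level `l` they are those of the next
directed automorphism if all letters of `w` are the last one, those of `blockOdo m 3 c` if the first
three letters of `w` are `0` and the number `c` of letters `1` in `w` is less than `n + 3`, and
trivial otherwise. -/
def countLabel (m n : ℕ) (v : List (Fin m)) : Equiv.Perm (Fin m) :=
  if _h : 3 * (n + 2) ≤ v.length then
    if ∀ x ∈ v.take (3 * (n + 2)), x.val + 1 = m then
      countLabel m (n + 1) (v.drop (3 * (n + 2)))
    else if (∀ x ∈ (v.take (3 * (n + 2))).take 3, x.val = 0) ∧
        (v.take (3 * (n + 2))).countP (fun x => x.val = 1) < n + 3 then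
      blockLabel m 3 ((v.take (3 * (n + 2))).countP fun x => x.val = 1) (v.drop (3 * (n + 2)))
    else 1
  else 1
termination_by v.length
decreasing_by simp only [List.length_drop]; omega

/-- The sections of `ofPortrait (countLabel m n)` at the vertices of level `3 * (n + 2)`. -/
def countPart (m n : ℕ) (w : List (Fin m)) : TreeAut m :=
  if ∀ x ∈ w, x.val + 1 = m then ofPortrait (countLabel m (n + 1))
  else if (∀ x ∈ w.take 3, x.val = 0) ∧ w.countP (fun x => x.val = 1) < n + 3 then
    blockOdo m 3 (w.countP fun x => x.val = 1)
  else 1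

theorem app_countLabel_append {n : ℕ} {v : List (Fin m)} (hv : v.length = 3 * (n + 2))
    (u : List (Fin m)) :
    app (ofPortrait (countLabel m n)) (v ++ u) = v ++ app (countPart m n v) u := by
  have h1 : ofPortrait (countLabel m n) ∈ levelStab m (3 * (n + 2)) :=
    ofPortrait_mem_levelStab fun w hw => by rw [countLabel, dif_neg (by omega)]
  have h2 : ∀ s, countLabel m n (v ++ s) =
      if ∀ x ∈ v, x.val + 1 = m then countLabel m (n + 1) s
      else if (∀ x ∈ v.take 3, x.val = 0) ∧ v.countP (fun x => x.val = 1) < n + 3 then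
        blockLabel m 3 (v.countP fun x => x.val = 1) s
      else 1 := by
    intro s
    rw [countLabel, dif_pos (by simp [hv]), ← hv, List.take_left, List.drop_left]
  rw [app_append, h1 v hv, sec_ofPortrait, countPart]
  simp only [h2]
  split_ifs
  · rfl
  · rfl
  · rw [ofPortrait_one]

theorem eq_replicate_last_iff (hm : 0 < m) {l : ℕ} {v : List (Fin m)} (hv : v.length = l) :
    v = List.replicate l (⟨m - 1, by omega⟩ : Fin m) ↔ ∀ x ∈ v, x.val + 1 = m := by
  rw [List.eq_replicate_iff]
  constructor
  · rintro ⟨_, h⟩ x hx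
    rw [h x hx]
    dsimp only
    omega
  · refine fun h => ⟨hv, fun x hx => Fin.ext ?_⟩
    have := h x hx
    dsimp only
    omega

/-- A directed system with blocks of three letters on the `m`-adic tree, for every `m ≥ 2`. -/
def threeLetterSystem (m : ℕ) (hm : 2 ≤ m) : DirectedSystem m 3 where
  blocks n := n + 2
  dir n := ofPortrait (countLabel m n)
  part := countPart m
  last n := List.replicate (3 * (n + 2)) ⟨m - 1, by omega⟩
  two_le := hm
  five_le := le_trans (by norm_num) (Nat.pow_le_pow_left hm 3)
  blocks_pos n := by omega
  tendsto_blocks := tendsto_add_atTop_nat 2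
  app_dir_append n v u hv := app_countLabel_append hv u
  length_last n := List.length_replicate
  firstBlock_last n := firstBlock_replicate_last (by omega) (by omega)
  part_last n := by
    rw [countPart, if_pos ((eq_replicate_last_iff (by omega) List.length_replicate).1 rfl)]
  part_mem n v hv hlast := by
    rw [Ne, eq_replicate_last_iff (by omega) hv] at hlast
    rw [countPart, if_neg hlast]
    split_ifs with h
    · exact blockOdo_mem_blockGroup h.2
    · exact one_mem _
  part_eq_one n v hv hlast h0 := by
    rw [Ne, eq_replicate_last_iff (by omega) hv] at hlast
    rw [countPart, if_neg hlast, if_neg]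
    rintro ⟨h, _⟩
    exact h0 (by rw [firstBlock, digitValue_eq_zero h, Nat.cast_zero])
  exists_part_eq n i hi := by
    let v : List (Fin m) := List.replicate (3 * (n + 2) - i) ⟨0, by omega⟩ ++
      List.replicate i ⟨1, by omega⟩
    have h3 : v.take 3 = List.replicate 3 ⟨0, by omega⟩ := by
      rw [List.take_append_of_le_length (by rw [List.length_replicate]; omega),
        List.take_replicate, min_eq_left (by omega)]
    have h0 : ∀ x ∈ v.take 3, x.val = 0 := by
      rw [h3]
      intro x hx
      rw [List.eq_of_mem_replicate hx]
    have hc : v.countP (fun x => x.val = 1) = i := by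
      simp [v, List.countP_append, List.countP_replicate]
    refine ⟨v, ?_, by rw [firstBlock, digitValue_eq_zero h0, Nat.cast_zero], ?_⟩
    · simp only [v, List.length_append, List.length_replicate]
      omega
    · have hz : (⟨0, by omega⟩ : Fin m) ∈ v.take 3 := by
        rw [h3]
        simp
      rw [countPart, if_neg fun H => ?_, if_pos ⟨h0, hc.trans_lt hi⟩, hc]
      have := H _ (List.mem_of_mem_take hz)
      dsimp only at this
      omega

end TreeAut

theorem mainTheorem5 (p : ℕ) (hp : p.Prime) :
    (∃ H : Subgroup (TreeAut p), H ≤ TreeAut.Gamma p ∧ IsClosed (H : Set (TreeAut p)) ∧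
      IsProP p H ∧ IsJustInfiniteProfinite H ∧ TreeAut.IsBranch H ∧
      TreeAut.hdim H = 0 ∧ TreeAut.metricHdim hp.two_le H = 0 ∧
      ∃ G : Subgroup (TreeAut p), G.FG ∧ TreeAut.IsBranch G ∧ IsJustInfinite G ∧
        G.topologicalClosure = H) ∧
    ∀ (q k : ℕ) (_ : q = p ^ k) (hq : 5 ≤ q) (n : ℕ),
      TreeAut.staircaseGroup q n ≤ TreeAut.Gamma q ∧
      (TreeAut.staircaseGroup q n).FG ∧
      TreeAut.LevelTransitive (TreeAut.staircaseGroup q n) ∧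
      TreeAut.IsBranch (TreeAut.staircaseGroup q n) ∧
      IsJustInfinite (TreeAut.staircaseGroup q n) ∧
      (TreeAut.staircaseGroup q n).topologicalClosure ≤ TreeAut.Gamma q ∧
      IsProP p (TreeAut.staircaseGroup q n).topologicalClosure ∧
      IsJustInfiniteProfinite (TreeAut.staircaseGroup q n).topologicalClosure ∧
      TreeAut.IsBranch (TreeAut.staircaseGroup q n).topologicalClosure ∧
      TreeAut.hdim (TreeAut.staircaseGroup q n).topologicalClosure = 0 ∧
      TreeAut.metricHdim (le_trans (by norm_num) hq)
        (TreeAut.staircaseGroup q n).topologicalClosure = 0 := by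
  refine ⟨?_, fun q k hqk hq n => ?_⟩
  · let S := TreeAut.threeLetterSystem p hp.two_le
    exact ⟨(S.group 0).topologicalClosure, S.closure_le_Gamma 0,
      Subgroup.isClosed_topologicalClosure _, S.isProP_closure 0 hp (pow_one p).symm,
      S.isJustInfiniteProfinite_closure 0, S.isBranch_closure 0, S.hdim_closure 0,
      S.metricHdim_closure 0 _, S.group 0, S.group_fg 0, S.isBranch_group 0,
      S.isJustInfinite_group 0, rfl⟩
  · rw [← TreeAut.staircaseSystem_group q hq n]
    let S := TreeAut.staircaseSystem q hq
    exact ⟨S.group_le_Gamma n, S.group_fg n, S.levelTransitive n, S.isBranch_group n,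
      S.isJustInfinite_group n, S.closure_le_Gamma n, S.isProP_closure n hp hqk,
      S.isJustInfiniteProfinite_closure n, S.isBranch_closure n, S.hdim_closure n,
      S.metricHdim_closure n _⟩
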